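/- Let $0<\theta<\pi/2$ and $\gamma>0$ be fixed, and put $$\alpha=\frac{\gamma}{1-e^{-\gamma}}-\frac{\gamma}{1-e^{\gamma}},\qquad \eta=\frac{-\gamma}{1-e^{-\gamma}},\qquad \beta=\frac{\gamma}{1-e^{\gamma}}.$$ For $N\ge 1$ let $C^\gamma\in\mathbb R^{2N\times 2N}$ be the tridiagonal matrix with diagonal $(\alpha+\beta,\alpha,\dots,\alpha,\alpha+\beta)$, whose rows $1,\dots,N$ have subdiagonal entry $\beta$ and superdiagonal entry $\eta$, and whose rows $N+1,\dots,2N$ have subdiagonal entry $\eta$ and superdiagonal entry $\beta$ (wherever these entries exist). Let $\mathcal C^{\theta,\gamma}=V^\theta C^\gamma$ with $V^\theta=\operatorname{diag}(e^{i\theta}I_N,e^{-i\theta}I_N)$. Define, for $\lambda,\mu\in\mathbb C$, $$\mu^{\pm\theta}(\lambda)=\frac{e^{\mp i\theta}\lambda-\alpha}{2\sqrt{\beta\eta}},\qquad a(\mu)=\mu+\sqrt{\mu+1}\,\sqrt{\mu-1}\quad\text{(principal square roots)},$$ and write $B_\varepsilon(S)$ for the open $\varepsilon$-neighbourhood of a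 set $S\subset\mathbb C$. Let $K=(\mu^{\theta})^{-1}([-1,1])\cup(\mu^{-\theta})^{-1}([-1,1])$. 1. There is an $\varepsilon_0>0$ such that for every $0<\varepsilon<\varepsilon_0$ there is an $N_0\in\mathbb N$ such that for all $N\ge N_0$: exactly two eigenvalues of $\mathcal C^{\theta,\gamma}$ lie outside $B_\varepsilon(K)$, and for each sign $\sigma=\pm1$ exactly $N-1$ eigenvalues lie in $B_\varepsilon\big((\mu^{\sigma\theta})^{-1}([-1,1])\big)$. All these counts hold both for distinct eigenvalues and for eigenvalues counted with algebraic multiplicity. 2. The limiting equation $a(\mu^{\theta}(\lambda))\,a(\mu^{-\theta}(\lambda))=e^{\gamma}$ has exactly two solutions $\lambda\in\mathbb C$, and both are real: they are $0$ and some $p>0$. -/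

import Mathlib

noncomputable section

/-- Coefficient `α = γ / (1 - e^{-γ}) - γ / (1 - e^γ)` (which equals `γ coth (γ / 2)`). -/
def alphaCoeff (γ : ℝ) : ℝ := γ / (1 - Real.exp (-γ)) - γ / (1 - Real.exp γ)

/-- Coefficient `η = -γ / (1 - e^{-γ})`. -/
def etaCoeff (γ : ℝ) : ℝ := -γ / (1 - Real.exp (-γ))

/-- Coefficient `β = γ / (1 - e^γ)`. -/
def betaCoeff (γ : ℝ) : ℝ := γ / (1 - Real.exp γ)

/-- The gauge capacitance matrix `C^γ`, real tridiagonal of size `2N`. The rows with (0-based)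
index `i < N` are `(β, α, η)`, those with index `i ≥ N` are `(η, α, β)`, and the two corner
diagonal entries are `α + β`. -/
def gaugeCapMatrix (γ : ℝ) (N : ℕ) : Matrix (Fin (2 * N)) (Fin (2 * N)) ℝ :=
  Matrix.of fun i j =>
    if i = j then
      if i.val = 0 ∨ i.val + 1 = 2 * N then alphaCoeff γ + betaCoeff γ else alphaCoeff γ
    else if j.val = i.val + 1 then
      if i.val < N then etaCoeff γ else betaCoeff γ
    else if i.val = j.val + 1 then
      if i.val < N then betaCoeff γ else etaCoeff γ
    else 0

/-- The material matrix `V^θ = diag(e^{iθ} I_N, e^{-iθ} I_N)`. -/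
def materialMatrix (θ : ℝ) (N : ℕ) : Matrix (Fin (2 * N)) (Fin (2 * N)) ℂ :=
  Matrix.diagonal fun i =>
    if i.val < N then Complex.exp (Complex.I * θ) else Complex.exp (-(Complex.I * θ))

/-- The generalised gauge capacitance matrix `C^{θ,γ} = V^θ C^γ`. -/
def genGaugeCapMatrix (θ γ : ℝ) (N : ℕ) : Matrix (Fin (2 * N)) (Fin (2 * N)) ℂ :=
  materialMatrix θ N * (gaugeCapMatrix γ N).map Complex.ofReal

/-- The affine map `μ^θ(z) = (e^{-iθ} z - α) / (2 √(β η))`. -/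
def muMap (θ γ : ℝ) (z : ℂ) : ℂ :=
  (Complex.exp (-(Complex.I * θ)) * z - (alphaCoeff γ : ℂ)) /
    (2 * (Real.sqrt (betaCoeff γ * etaCoeff γ) : ℂ))

/-- The map `a(μ) = μ + √(μ + 1) √(μ - 1)` with principal square roots. -/
def aMap (μ : ℂ) : ℂ := μ + (μ + 1) ^ (1 / 2 : ℂ) * (μ - 1) ^ (1 / 2 : ℂ)

/-- The line segment `(μ^θ)⁻¹([-1, 1])` in the complex plane. -/
def muSegment (θ γ : ℝ) : Set ℂ :=
  muMap θ γ ⁻¹' (Complex.ofReal '' Set.Icc (-1) 1)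

open scoped Classical in
/-- The number of eigenvalues of `A` lying in `S`, counted with algebraic multiplicity. -/
def eigenvalueCount {n : ℕ} (A : Matrix (Fin n) (Fin n) ℂ) (S : Set ℂ) : ℕ :=
  (A.charpoly.roots.filter fun z => z ∈ S).card

end

noncomputable section
open Polynomial Filter Topology

/-- The characteristic continuants of half of the chain: monic polynomials satisfying the
Chebyshev recursion, with a boundary perturbation `κ`. -/
def edgePoly (κ : ℂ) : ℕ → ℂ[X]
  | 0 => 1
  | 1 => X + C κ
  | n + 2 => X * edgePoly κ (n + 1) - edgePoly κ n

lemma edgePoly_eval_add_two (κ x : ℂ) (n : ℕ) :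
    (edgePoly κ (n + 2)).eval x = x * (edgePoly κ (n + 1)).eval x - (edgePoly κ n).eval x := by
  simp [edgePoly]

lemma edgePoly_monic_natDegree (κ : ℂ) (n : ℕ) :
    ((edgePoly κ n).Monic ∧ (edgePoly κ n).natDegree = n) ∧
      (edgePoly κ (n + 1)).Monic ∧ (edgePoly κ (n + 1)).natDegree = n + 1 := by
  induction n with
  | zero => simp [edgePoly, monic_X_add_C]
  | succ n ih =>
    obtain ⟨⟨_, h2⟩, h3, h4⟩ := ih
    refine ⟨⟨h3, h4⟩, ?_⟩
    have hm : (X * edgePoly κ (n + 1)).Monic := monic_X.mul h3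
    have hd : (X * edgePoly κ (n + 1)).natDegree = n + 2 := by
      rw [monic_X.natDegree_mul h3, h4, natDegree_X]; ring
    have hlt : (edgePoly κ n).degree < (X * edgePoly κ (n + 1)).degree := by
      apply degree_lt_degree; omega
    refine ⟨hm.sub_of_left hlt, ?_⟩
    rw [edgePoly, natDegree_sub_eq_left_of_natDegree_lt (by omega), hd]

lemma edgePoly_natDegree (κ : ℂ) (n : ℕ) : (edgePoly κ n).natDegree = n :=
  (edgePoly_monic_natDegree κ n).1.2

lemma edgePoly_eval_succ_sub (κ : ℂ) {b : ℂ} (hb : b ≠ 0) (n : ℕ) :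
    (edgePoly κ (n + 1)).eval (b + b⁻¹) - b * (edgePoly κ n).eval (b + b⁻¹) =
      b⁻¹ ^ n * (b⁻¹ + κ) := by
  induction n with
  | zero => simp [edgePoly]; ring
  | succ n ih =>
    rw [edgePoly_eval_add_two, pow_succ, mul_assoc, mul_left_comm, ← ih]
    field_simp
    ring

lemma edgePoly_eval_closed (κ : ℂ) {b : ℂ} (hb : b ≠ 0) (n : ℕ) :
    (edgePoly κ n).eval (b + b⁻¹) * (b - b⁻¹) = b ^ n * (b + κ) - b⁻¹ ^ n * (b⁻¹ + κ) := by
  have h1 := edgePoly_eval_succ_sub κ hb n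
  have h2 := edgePoly_eval_succ_sub κ (inv_ne_zero hb) n
  rw [inv_inv, add_comm b⁻¹ b] at h2
  linear_combination h2 - h1

lemma edgePoly_eval_ne_zero_of_succ (κ x : ℂ) (n : ℕ) (h : (edgePoly κ (n + 1)).eval x = 0) :
    (edgePoly κ n).eval x ≠ 0 := by
  induction n with
  | zero => simp [edgePoly]
  | succ n ih =>
    intro h0
    apply ih h0
    rw [edgePoly_eval_add_two, h0] at h
    simpa using h

lemma edgePoly_eval_conj (κ : ℝ) (x : ℂ) (n : ℕ) :
    (edgePoly κ n).eval (starRingEnd ℂ x) = starRingEnd ℂ ((edgePoly κ n).eval x) := by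
  induction n using Nat.twoStepInduction with
  | zero => simp [edgePoly]
  | one => simp [edgePoly]
  | more n h1 h2 => simp [edgePoly_eval_add_two, h1, h2]

lemma edgePoly_eval_base {r : ℂ} (hr : r ≠ 0) (n : ℕ) :
    (edgePoly r⁻¹ n).eval (-(r + r⁻¹)) = (-r) ^ n := by
  induction n using Nat.twoStepInduction with
  | zero => simp [edgePoly]
  | one => simp [edgePoly]
  | more n h1 h2 =>
    rw [edgePoly_eval_add_two, h1, h2, pow_succ, pow_succ]
    field_simp
    ring

lemma edgePoly_derivative_base {r : ℝ} (hr : 0 < r) (n : ℕ) :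
    ∃ c : ℝ, 0 < c ∧ (derivative (edgePoly (r : ℂ)⁻¹ (n + 1))).eval (-((r : ℂ) + (r : ℂ)⁻¹)) +
      r * (derivative (edgePoly (r : ℂ)⁻¹ n)).eval (-((r : ℂ) + (r : ℂ)⁻¹)) = (-1) ^ n * c := by
  have hr' : (r : ℂ) ≠ 0 := by exact_mod_cast hr.ne'
  induction n with
  | zero => exact ⟨1, one_pos, by simp [edgePoly]⟩
  | succ n ih =>
    obtain ⟨c, hc, h⟩ := ih
    refine ⟨r ^ (n + 1) + c / r, by positivity, ?_⟩
    have hb := edgePoly_eval_base hr' (n + 1)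
    rw [edgePoly]
    simp only [derivative_sub, derivative_mul, derivative_X, one_mul, eval_add, eval_sub,
      eval_mul, eval_X, hb]
    have h' := congrArg (fun z => -(r : ℂ)⁻¹ * z) h
    push_cast
    rw [neg_pow, pow_succ (-1 : ℂ) n]
    field_simp at h' ⊢
    linear_combination h'

/-- The secular polynomial of the chain with `2 (m + 1)` sites, in the rescaled spectral
variable. -/
def secPoly (θ r : ℝ) (m : ℕ) : ℂ[X] :=
  (edgePoly (r : ℂ)⁻¹ (m + 1)).comp
      (C (Complex.exp (-(Complex.I * θ))) * X + C (-((r : ℂ) + (r : ℂ)⁻¹))) *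
    (edgePoly (r : ℂ)⁻¹ (m + 1)).comp
      (C (Complex.exp (Complex.I * θ)) * X + C (-((r : ℂ) + (r : ℂ)⁻¹))) -
  C ((r : ℂ) ^ 2) * ((edgePoly (r : ℂ)⁻¹ m).comp
      (C (Complex.exp (-(Complex.I * θ))) * X + C (-((r : ℂ) + (r : ℂ)⁻¹))) *
    (edgePoly (r : ℂ)⁻¹ m).comp
      (C (Complex.exp (Complex.I * θ)) * X + C (-((r : ℂ) + (r : ℂ)⁻¹))))

lemma secPoly_eval (θ r : ℝ) (m : ℕ) (t : ℂ) : (secPoly θ r m).eval t =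
    (edgePoly (r : ℂ)⁻¹ (m + 1)).eval (Complex.exp (-(Complex.I * θ)) * t - (r + (r : ℂ)⁻¹)) *
    (edgePoly (r : ℂ)⁻¹ (m + 1)).eval (Complex.exp (Complex.I * θ) * t - (r + (r : ℂ)⁻¹)) -
    (r : ℂ) ^ 2 * ((edgePoly (r : ℂ)⁻¹ m).eval
      (Complex.exp (-(Complex.I * θ)) * t - (r + (r : ℂ)⁻¹)) *
    (edgePoly (r : ℂ)⁻¹ m).eval (Complex.exp (Complex.I * θ) * t - (r + (r : ℂ)⁻¹))) := by
  simp [secPoly, sub_eq_add_neg]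

lemma secPoly_natDegree (θ r : ℝ) (m : ℕ) : (secPoly θ r m).natDegree = 2 * (m + 1) := by
  have hl : ∀ z : ℂ, (C (Complex.exp z) * X +
      C (-((r : ℂ) + (r : ℂ)⁻¹))).natDegree = 1 := fun z =>
    natDegree_linear (Complex.exp_ne_zero _)
  have hc : ∀ (z : ℂ) (n : ℕ), ((edgePoly (r : ℂ)⁻¹ n).comp (C (Complex.exp z) * X +
      C (-((r : ℂ) + (r : ℂ)⁻¹)))).natDegree = n := fun z n => by
    rw [natDegree_comp, hl, edgePoly_natDegree, mul_one]
  have hne : ∀ z : ℂ, (edgePoly (r : ℂ)⁻¹ (m + 1)).comp (C (Complex.exp z) * X +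
      C (-((r : ℂ) + (r : ℂ)⁻¹))) ≠ 0 := fun z h => by
    have := hc z (m + 1)
    rw [h, natDegree_zero] at this
    omega
  have h1 : ((edgePoly (r : ℂ)⁻¹ (m + 1)).comp
      (C (Complex.exp (-(Complex.I * θ))) * X + C (-((r : ℂ) + (r : ℂ)⁻¹))) *
    (edgePoly (r : ℂ)⁻¹ (m + 1)).comp
      (C (Complex.exp (Complex.I * θ)) * X + C (-((r : ℂ) + (r : ℂ)⁻¹)))).natDegree
      = 2 * (m + 1) := by
    rw [natDegree_mul (hne _) (hne _), hc, hc]; ring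
  rw [secPoly, natDegree_sub_eq_left_of_natDegree_lt, h1]
  rw [h1]
  refine (natDegree_C_mul_le _ _).trans_lt (natDegree_mul_le.trans_lt ?_)
  rw [hc, hc]; omega

lemma conj_exp_I_mul (θ : ℝ) :
    starRingEnd ℂ (Complex.exp (Complex.I * θ)) = Complex.exp (-(Complex.I * θ)) := by
  rw [← Complex.exp_conj]; simp

lemma secPoly_eval_conj (θ r : ℝ) (m : ℕ) (t : ℂ) :
    (secPoly θ r m).eval (starRingEnd ℂ t) = starRingEnd ℂ ((secPoly θ r m).eval t) := by
  have h1 : Complex.exp (-(Complex.I * θ)) * starRingEnd ℂ t - (r + (r : ℂ)⁻¹) =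
      starRingEnd ℂ (Complex.exp (Complex.I * θ) * t - (r + (r : ℂ)⁻¹)) := by
    rw [← conj_exp_I_mul]; simp
  have h2 : Complex.exp (Complex.I * θ) * starRingEnd ℂ t - (r + (r : ℂ)⁻¹) =
      starRingEnd ℂ (Complex.exp (-(Complex.I * θ)) * t - (r + (r : ℂ)⁻¹)) := by
    rw [← conj_exp_I_mul]; simp
  have hk := edgePoly_eval_conj r⁻¹
  push_cast at hk
  rw [secPoly_eval, secPoly_eval, h1, h2]
  rw [hk, hk, hk, hk]
  simp only [map_sub (starRingEnd ℂ) (_ * _) (_ * _), map_mul, map_pow, Complex.conj_ofReal]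
  ring

lemma secPoly_eval_zero (θ : ℝ) {r : ℝ} (hr : 0 < r) (m : ℕ) : (secPoly θ r m).eval 0 = 0 := by
  have hr' : (r : ℂ) ≠ 0 := by exact_mod_cast hr.ne'
  have h := edgePoly_eval_base hr'
  rw [secPoly_eval]
  simp only [mul_zero, zero_sub, h]
  ring

lemma secPoly_derivative_zero_ne {θ r : ℝ} (hr : 0 < r) (hθ : 0 < Real.cos θ) (m : ℕ) :
    (derivative (secPoly θ r m)).eval 0 ≠ 0 := by
  have hr' : (r : ℂ) ≠ 0 := by exact_mod_cast hr.ne'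
  obtain ⟨c, hc, h⟩ := edgePoly_derivative_base hr m
  have hb := edgePoly_eval_base hr'
  have hcos : Complex.exp (Complex.I * θ) + Complex.exp (-(Complex.I * θ)) =
      2 * (Real.cos θ : ℂ) := by
    push_cast
    rw [Complex.cos, mul_comm Complex.I, neg_mul]; ring
  have key : (derivative (secPoly θ r m)).eval 0 =
      -(2 * Real.cos θ * (r ^ (m + 1) * c) : ℝ) := by
    simp only [secPoly, derivative_sub, derivative_mul, derivative_comp, derivative_add,
      derivative_C, derivative_X, eval_sub, eval_add, eval_mul, eval_comp, eval_C, eval_X,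
      mul_zero, zero_add, hb, zero_mul, mul_one, add_zero,]
    have h1 : ((-1 : ℂ) ^ m) * (-1) ^ m = 1 := by rw [← mul_pow]; simp
    push_cast at hcos ⊢
    rw [neg_pow, neg_pow (r : ℂ) m]
    generalize (derivative (edgePoly (r : ℂ)⁻¹ (m + 1))).eval (-((r : ℂ) + (r : ℂ)⁻¹)) = A at *
    generalize (derivative (edgePoly (r : ℂ)⁻¹ m)).eval (-((r : ℂ) + (r : ℂ)⁻¹)) = B at *
    rw [pow_succ (-1 : ℂ) m, pow_succ (r : ℂ) m]
    have hA : A = (-1) ^ m * c - r * B := by linear_combination h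
    rw [hA]
    linear_combination (-(r : ℂ) ^ m * r * c * (-1) ^ m * (-1) ^ m) * hcos
      - 2 * Complex.cos θ * r ^ m * r * c * h1
  rw [key, neg_ne_zero, Complex.ofReal_ne_zero]
  positivity

lemma gaugeCapMatrix_mulVec (γ : ℝ) (N : ℕ) (v : ℕ → ℂ) (i : Fin (2 * N)) :
    (((gaugeCapMatrix γ N).map Complex.ofReal).mulVec fun j => v j.val) i =
      (if i.val = 0 ∨ i.val + 1 = 2 * N then (alphaCoeff γ + betaCoeff γ : ℂ)
        else alphaCoeff γ) * v i +
      (if i.val + 1 < 2 * N then (if i.val < N then (etaCoeff γ : ℂ) else betaCoeff γ) *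
        v (i + 1) else 0) +
      (if 1 ≤ i.val then (if i.val < N then (betaCoeff γ : ℂ) else etaCoeff γ) *
        v (i - 1) else 0) := by
  obtain ⟨i, hi⟩ := i
  set d : ℂ := if i = 0 ∨ i + 1 = 2 * N then (alphaCoeff γ + betaCoeff γ : ℂ) else alphaCoeff γ
    with hd
  set u : ℂ := if i < N then (etaCoeff γ : ℂ) else betaCoeff γ with hu
  set l : ℂ := if i < N then (betaCoeff γ : ℂ) else etaCoeff γ with hl
  have hsum : (((gaugeCapMatrix γ N).map Complex.ofReal).mulVec fun j => v j.val) ⟨i, hi⟩ =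
      ∑ j ∈ Finset.range (2 * N), ((if i = j then d * v j else 0) +
        (if i + 1 = j then u * v j else 0) +
        (if 1 ≤ i then if i - 1 = j then l * v j else 0 else 0)) := by
    rw [Matrix.mulVec, dotProduct, Finset.sum_range]
    refine Finset.sum_congr rfl fun j _ => ?_
    simp only [gaugeCapMatrix, Matrix.map_apply, Matrix.of_apply, Fin.ext_iff]
    by_cases h1 : i = j.val
    · rw [if_pos h1, if_pos h1, if_neg (show ¬ i + 1 = j.val by omega)]
      have : ¬ (1 ≤ i ∧ i - 1 = j.val) := by omega
      rw [← ite_and, if_neg this, hd]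
      split_ifs <;> push_cast <;> ring
    · rw [if_neg h1, if_neg h1]
      by_cases h2 : j.val = i + 1
      · have : ¬ (1 ≤ i ∧ i - 1 = j.val) := by omega
        rw [if_pos h2, if_pos h2.symm, ← ite_and, if_neg this, hu]
        split_ifs <;> ring
      · rw [if_neg h2, if_neg (Ne.symm h2), ← ite_and]
        by_cases h3 : i = j.val + 1
        · have : (1 ≤ i ∧ i - 1 = j.val) := by omega
          rw [if_pos h3, if_pos this, hl]
          split_ifs <;> ring
        · have : ¬ (1 ≤ i ∧ i - 1 = j.val) := by omega
          rw [if_neg h3, if_neg this]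
          simp
  rw [hsum, Finset.sum_add_distrib, Finset.sum_add_distrib, Finset.sum_ite_eq,
    Finset.sum_ite_eq, if_pos (Finset.mem_range.2 hi)]
  simp only [Finset.mem_range]
  congr 1
  by_cases h : 1 ≤ i
  · simp only [if_pos h, Finset.sum_ite_eq, Finset.mem_range]
    rw [if_pos (by omega)]
  · simp [h]

/-- A vector solving the three-term recursion, with suitable boundary values, is an
eigenvector of the generalised gauge capacitance matrix. -/
lemma mem_spectrum_of_recursion {θ γ : ℝ} {N : ℕ} {v : ℕ → ℂ} {z : ℂ}
    (hv : ∃ i < 2 * N, v i ≠ 0)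
    (h : ∀ i < 2 * N, (if i < N then Complex.exp (Complex.I * θ)
        else Complex.exp (-(Complex.I * θ))) *
      ((if i = 0 ∨ i + 1 = 2 * N then (alphaCoeff γ + betaCoeff γ : ℂ)
        else alphaCoeff γ) * v i +
      (if i + 1 < 2 * N then (if i < N then (etaCoeff γ : ℂ) else betaCoeff γ) *
        v (i + 1) else 0) +
      (if 1 ≤ i then (if i < N then (betaCoeff γ : ℂ) else etaCoeff γ) *
        v (i - 1) else 0)) = z * v i) :
    z ∈ spectrum ℂ (genGaugeCapMatrix θ γ N) := by
  rw [spectrum.mem_iff, Matrix.isUnit_iff_isUnit_det, isUnit_iff_ne_zero, not_not,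
    ← Matrix.exists_mulVec_eq_zero_iff]
  obtain ⟨i, hi, hvi⟩ := hv
  refine ⟨fun j => v j.val, fun h0 => hvi (congrFun h0 ⟨i, hi⟩), ?_⟩
  funext j
  rw [Matrix.sub_mulVec, Algebra.algebraMap_eq_smul_one, Matrix.smul_mulVec, Matrix.one_mulVec,
    genGaugeCapMatrix, materialMatrix, ← Matrix.mulVec_mulVec, Pi.sub_apply,
    Matrix.mulVec_diagonal, gaugeCapMatrix_mulVec, h j j.2]
  simp

/-- Parametrisation of the coefficients by `r = e^{γ/2}` and `s = √(β η)`. -/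
structure CoeffData (γ r s : ℝ) : Prop where
  one_lt : 1 < r
  pos : 0 < s
  alpha : alphaCoeff γ = s * (r + r⁻¹)
  eta : etaCoeff γ = -(s * r)
  beta : betaCoeff γ = -(s * r⁻¹)
  sqrt_eq : Real.sqrt (betaCoeff γ * etaCoeff γ) = s
  exp_eq : Real.exp γ = r ^ 2

lemma exists_coeffData {γ : ℝ} (hγ : 0 < γ) : ∃ r s, CoeffData γ r s := by
  have hr : 1 < Real.exp (γ / 2) := Real.one_lt_exp_iff.2 (by positivity)
  have he : Real.exp γ = Real.exp (γ / 2) ^ 2 := by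
    rw [← Real.exp_nat_mul]; congr 1; push_cast; ring
  generalize Real.exp (γ / 2) = r at hr he
  have hr0 : 0 < r := by linarith
  have hr2 : 0 < r ^ 2 - 1 := by nlinarith
  have h2 : 1 - r ^ 2 ≠ 0 := by linarith
  have h3 : 1 - (r ^ 2)⁻¹ ≠ 0 := by
    intro h
    field_simp at h
    linarith
  have heta : etaCoeff γ = -(γ * r / (r ^ 2 - 1) * r) := by
    rw [etaCoeff, Real.exp_neg, he]; field_simp
  have hbeta : betaCoeff γ = -(γ * r / (r ^ 2 - 1) * r⁻¹) := by
    rw [betaCoeff, he, ← neg_sub (r ^ 2) 1]; field_simp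
  have halpha : alphaCoeff γ = -etaCoeff γ - betaCoeff γ := by
    rw [alphaCoeff, etaCoeff, betaCoeff]; ring
  have hs : 0 < γ * r / (r ^ 2 - 1) := by positivity
  refine ⟨r, γ * r / (r ^ 2 - 1), hr, hs, ?_, heta, hbeta, ?_, he⟩
  · rw [halpha, heta, hbeta]; ring
  · rw [heta, hbeta, Real.sqrt_eq_iff_mul_self_eq_of_pos hs]
    field_simp

lemma mem_spectrum_of_secPoly_root {θ γ r s : ℝ} (hc : CoeffData γ r s) {m : ℕ} {t : ℂ}
    (ht : (secPoly θ r m).eval t = 0) :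
    (s : ℂ) * t ∈ spectrum ℂ (genGaugeCapMatrix θ γ (m + 1)) := by
  have hr : (r : ℂ) ≠ 0 := by exact_mod_cast (zero_lt_one.trans hc.one_lt).ne'
  rw [secPoly_eval] at ht
  set R : ℂ := (r : ℂ) + (r : ℂ)⁻¹ with hR
  set e₁ := Complex.exp (Complex.I * θ) with he₁
  set e₂ := Complex.exp (-(Complex.I * θ)) with he₂
  have hee : e₁ * e₂ = 1 := by rw [he₁, he₂, ← Complex.exp_add]; simp
  set x : ℂ := e₂ * t - R with hx
  set y : ℂ := e₁ * t - R with hy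
  set P : ℕ → ℂ := fun n => (edgePoly (r : ℂ)⁻¹ n).eval x with hP
  set Q : ℕ → ℂ := fun n => (edgePoly (r : ℂ)⁻¹ n).eval y with hQ
  have hP2 : ∀ n, P (n + 2) = x * P (n + 1) - P n := edgePoly_eval_add_two _ x
  have hQ2 : ∀ n, Q (n + 2) = y * Q (n + 1) - Q n := edgePoly_eval_add_two _ y
  have hP0 : P 0 = 1 := by simp [hP, edgePoly]
  have hQ0 : Q 0 = 1 := by simp [hQ, edgePoly]
  have hP1 : P 1 = x + (r : ℂ)⁻¹ := by simp [hP, edgePoly]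
  have hQ1 : Q 1 = y + (r : ℂ)⁻¹ := by simp [hQ, edgePoly]
  replace ht : P (m + 1) * Q (m + 1) = r ^ 2 * (P m * Q m) := sub_eq_zero.1 ht
  -- amplitudes on both halves
  obtain ⟨A, B, hA, h1, h2⟩ : ∃ A B : ℂ, A ≠ 0 ∧
      r * (A * P m) = -(B * Q (m + 1)) ∧ A * P (m + 1) = -(r * (B * Q m)) := by
    by_cases hq : Q (m + 1) = 0
    · have hq' : Q m ≠ 0 := edgePoly_eval_ne_zero_of_succ _ _ _ hq
      have hp : P m = 0 := by
        rw [hq, mul_zero, eq_comm] at ht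
        simpa [hr, hq'] using ht
      refine ⟨Q m, -((r : ℂ)⁻¹ * P (m + 1)), hq', ?_, ?_⟩
      · rw [hp, hq]; ring
      · field_simp
    · refine ⟨Q (m + 1), -(r * P m), hq, by ring, ?_⟩
      linear_combination ht
  obtain ⟨k, hk⟩ : ∃ k : ℂ, k = -(r : ℂ)⁻¹ := ⟨_, rfl⟩
  have hk' : (r : ℂ)⁻¹ = -k := by rw [hk, neg_neg]
  have hrk : r * k = -1 := by rw [hk]; field_simp
  have hkR : R = r - k := by rw [hR, hk]; ring
  set v : ℕ → ℂ := fun i => if i < m + 1 then A * (k ^ i * P i)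
    else B * (k ^ (2 * m + 1 - i) * Q (2 * m + 1 - i)) with hv
  have hvl : ∀ i ≤ m + 1, v i = A * (k ^ i * P i) := by
    intro i hi
    by_cases h : i < m + 1
    · simp only [hv, if_pos h]
    · obtain rfl : i = m + 1 := by omega
      simp only [hv, if_neg h]
      rw [show 2 * m + 1 - (m + 1) = m by omega, pow_succ]
      linear_combination (-k ^ m * k) * h2 + B * k ^ m * Q m * hrk
  have hvr : ∀ j ≤ m + 1, v (2 * m + 1 - j) = B * (k ^ j * Q j) := by
    intro i hi
    by_cases h : i < m + 1
    · simp only [hv]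
      rw [if_neg (by omega), show 2 * m + 1 - (2 * m + 1 - i) = i by omega]
    · obtain rfl : i = m + 1 := by omega
      simp only [hv]
      rw [if_pos (by omega), show 2 * m + 1 - (m + 1) = m by omega, pow_succ]
      linear_combination (-k ^ m * k) * h1 + A * k ^ m * P m * hrk
  have ha : (alphaCoeff γ : ℂ) = s * (r - k) := by rw [hc.alpha, ← hkR, hR]; push_cast; ring
  have hb : (betaCoeff γ : ℂ) = s * k := by rw [hc.beta, hk]; push_cast; ring
  have he : (etaCoeff γ : ℂ) = -(s * r) := by rw [hc.eta]; push_cast; ring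
  have het : e₁ * (x + R) = t := by rw [hx]; linear_combination t * hee
  have het' : e₂ * (y + R) = t := by rw [hy]; linear_combination t * hee
  rw [hkR] at het het'
  apply mem_spectrum_of_recursion (v := v)
  · exact ⟨0, by omega, by rw [hvl 0 (by omega), hP0]; simpa using hA⟩
  intro i hi
  rw [ha, hb, he]
  by_cases hiN : i < m + 1
  · rw [if_pos hiN, if_pos (show i + 1 < 2 * (m + 1) by omega), if_pos hiN, if_pos hiN]
    rw [hvl (i + 1) (by omega), hvl i (by omega)]
    rcases i with _ | i
    · rw [if_pos (Or.inl rfl), if_neg (by omega), hP1, hP0, ← het, hk']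
      linear_combination (-e₁ * s * A * (x - k)) * hrk
    · rw [if_neg (by omega), if_pos (by omega), Nat.add_sub_cancel, hvl i (by omega), hP2, ← het,
        pow_succ, pow_succ]
      linear_combination (-e₁ * s * A * k ^ i * k * (x * P (i + 1) - P i)) * hrk
  · obtain ⟨j, hj, rfl⟩ : ∃ j ≤ m, i = 2 * m + 1 - j := ⟨2 * m + 1 - i, by omega, by omega⟩
    rw [if_neg hiN, if_neg hiN, if_neg hiN, if_pos (show 1 ≤ 2 * m + 1 - j by omega)]
    rw [show 2 * m + 1 - j - 1 = 2 * m + 1 - (j + 1) by omega, hvr (j + 1) (by omega),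
      hvr j (by omega)]
    rcases j with _ | j
    · rw [if_pos (Or.inr (by omega)), if_neg (by omega), hQ1, hQ0, ← het', hk']
      linear_combination (-e₂ * s * B * (y - k)) * hrk
    · rw [if_neg (by omega), if_pos (by omega),
        show 2 * m + 1 - (j + 1) + 1 = 2 * m + 1 - j by omega, hvr j (by omega), hQ2, ← het',
        pow_succ, pow_succ]
      linear_combination (-e₂ * s * B * k ^ j * k * (y * Q (j + 1) - Q j)) * hrk

/-- For `y` in the upper half plane, the solution of `b + b⁻¹ = y` outside the unit disc. -/
def upperRoot (y : ℂ) : ℂ := (y + Complex.I * Complex.exp (Complex.log (4 - y ^ 2) / 2)) / 2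

lemma four_sub_sq_mem_slitPlane {y : ℂ} (hy : 0 < y.im) : 4 - y ^ 2 ∈ Complex.slitPlane := by
  rw [Complex.mem_slitPlane_iff]
  by_cases h : y.re = 0
  · left
    simp [pow_two, h]
    nlinarith
  · right
    simp [pow_two]
    intro h2
    have : y.re * y.im = 0 := by linarith
    simp [h, hy.ne'] at this

lemma continuousAt_upperRoot {y : ℂ} (hy : 0 < y.im) : ContinuousAt upperRoot y := by
  have h1 : ContinuousAt (fun y : ℂ => Complex.log (4 - y ^ 2)) y :=
    (by fun_prop : ContinuousAt (fun y : ℂ => 4 - y ^ 2) y).clog (four_sub_sq_mem_slitPlane hy)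
  unfold upperRoot
  fun_prop

lemma re_exp_half_log_pos {z : ℂ} (hz : z ∈ Complex.slitPlane) :
    0 < (Complex.exp (Complex.log z / 2)).re := by
  rw [Complex.exp_re]
  refine mul_pos (Real.exp_pos _) (Real.cos_pos_of_mem_Ioo ?_)
  have h1 := Complex.neg_pi_lt_log_im z
  have h2 := Complex.log_im_le_pi z
  have h3 := (Complex.mem_slitPlane_iff_arg.1 hz).1
  rw [← Complex.log_im] at h3
  have h4 : (Complex.log z / 2).im = (Complex.log z).im / 2 := by simp
  rw [h4]
  have := lt_of_le_of_ne h2 h3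
  constructor <;> linarith

lemma upperRoot_spec {y : ℂ} (hy : 0 < y.im) :
    1 < ‖upperRoot y‖ ∧ upperRoot y + (upperRoot y)⁻¹ = y := by
  have hs := four_sub_sq_mem_slitPlane hy
  have hw : Complex.exp (Complex.log (4 - y ^ 2) / 2) ^ 2 = 4 - y ^ 2 := by
    rw [← Complex.exp_nat_mul]
    push_cast
    rw [mul_div_cancel₀ _ two_ne_zero, Complex.exp_log (Complex.slitPlane_ne_zero hs)]
  have hre := re_exp_half_log_pos hs
  have him : 0 < (upperRoot y).im := by
    have : (upperRoot y).im = (y.im + (Complex.exp (Complex.log (4 - y ^ 2) / 2)).re) / 2 := by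
      simp only [upperRoot]
      rw [show (2 : ℂ) = ((2 : ℝ) : ℂ) by norm_num, Complex.div_ofReal_im]
      simp
    rw [this]; linarith
  have hb : upperRoot y ≠ 0 := fun h => by simp [h] at him
  have hsum : upperRoot y + (upperRoot y)⁻¹ = y := by
    have : upperRoot y ^ 2 - y * upperRoot y + 1 = 0 := by
      unfold upperRoot
      linear_combination (-1 / 4 : ℂ) * hw + (1 / 4 : ℂ) *
        Complex.exp (Complex.log (4 - y ^ 2) / 2) ^ 2 * Complex.I_sq
    field_simp
    linear_combination this
  refine ⟨?_, hsum⟩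
  have h1 : y.im = (upperRoot y).im - (upperRoot y).im / Complex.normSq (upperRoot y) := by
    conv_lhs => rw [← hsum]
    simp [Complex.inv_im]; ring
  have h2 : 0 < Complex.normSq (upperRoot y) := Complex.normSq_pos.2 hb
  by_contra hle
  have h3 : Complex.normSq (upperRoot y) ≤ 1 := by
    rw [Complex.normSq_eq_norm_sq]
    exact pow_le_one₀ (norm_nonneg _) (not_lt.1 hle)
  have h4 : (upperRoot y).im ≤ (upperRoot y).im / Complex.normSq (upperRoot y) := by
    rw [le_div_iff₀ h2]; nlinarith
  linarith

lemma one_sub_mem_slitPlane_of_norm_eq {r : ℝ} (hr : 1 < r) {a b u : ℂ} (ha : ‖a‖ = 1)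
    (hu : ‖u‖ = 1)
    (h : b + b⁻¹ + (r + (r : ℂ)⁻¹) = u * (a + a⁻¹ + (r + (r : ℂ)⁻¹))) :
    1 - a * b / (r : ℂ) ^ 2 ∈ Complex.slitPlane := by
  by_contra hns
  rw [Complex.mem_slitPlane_iff, not_or, not_lt, not_not] at hns
  obtain ⟨h1, h2⟩ := hns
  have hr0 : 0 < r := by linarith
  have hrc : (r : ℂ) ≠ 0 := by exact_mod_cast hr0.ne'
  obtain ⟨T, hT, hT2⟩ : ∃ T : ℝ, a * b = T ∧ r ^ 2 ≤ T := by
    refine ⟨r ^ 2 * (1 - (1 - a * b / (r : ℂ) ^ 2).re), ?_, ?_⟩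
    · have : (1 - a * b / (r : ℂ) ^ 2) = ((1 - a * b / (r : ℂ) ^ 2).re : ℂ) := by
        apply Complex.ext <;> simp only [Complex.ofReal_re, Complex.ofReal_im, h2]
      push_cast
      rw [← this]
      field_simp
      ring
    · nlinarith [sq_nonneg r]
  have hT1 : 1 < T := by nlinarith
  have hT0 : 0 < T := by linarith
  have hTc : (T : ℂ) ≠ 0 := by exact_mod_cast hT0.ne'
  have ha0 : a ≠ 0 := fun h => by simp [h] at ha
  have hinv : a⁻¹ = starRingEnd ℂ a := by
    rw [Complex.inv_def, Complex.normSq_eq_norm_sq, ha]; simp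
  have hb : b = T * starRingEnd ℂ a := by
    rw [← hinv, ← hT]; field_simp
  have hb' : b⁻¹ = (T⁻¹ : ℝ) * a := by
    rw [hb, ← hinv, mul_inv, inv_inv]; push_cast; rfl
  have hn := congrArg Complex.normSq h
  rw [map_mul, Complex.normSq_eq_norm_sq u, hu, hb', hb, hinv] at hn
  have hac : a.re ^ 2 + a.im ^ 2 = 1 := by
    have := Complex.normSq_eq_norm_sq a
    rw [ha, Complex.normSq_apply] at this
    linarith
  rw [show (r : ℂ) + (r : ℂ)⁻¹ = ((r + r⁻¹ : ℝ) : ℂ) by push_cast; rfl] at hn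
  simp only [Complex.normSq_apply, Complex.add_re, Complex.add_im, Complex.mul_re, Complex.mul_im,
    Complex.conj_re, Complex.conj_im, Complex.ofReal_re, Complex.ofReal_im] at hn
  obtain ⟨R, hR⟩ : ∃ R, R = r + r⁻¹ := ⟨_, rfl⟩
  obtain ⟨S, hS⟩ : ∃ S, S = T + T⁻¹ := ⟨_, rfl⟩
  rw [← hR] at hn
  have hTT : T * T⁻¹ = 1 := mul_inv_cancel₀ hT0.ne'
  have hrr : r * r⁻¹ = 1 := mul_inv_cancel₀ hr0.ne'
  have hSS : S ^ 2 = (T - T⁻¹) ^ 2 + 4 := by rw [hS]; linear_combination 4 * hTT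
  have hri : r⁻¹ < 1 := inv_lt_one_of_one_lt₀ hr
  have hR2 : 2 < R := by
    have : 0 < (r - 1) * (1 - r⁻¹) := mul_pos (by linarith) (by linarith)
    nlinarith
  have hSR : R ^ 2 - 2 ≤ S := by
    have h0 : R ^ 2 - 2 = r ^ 2 + (r⁻¹) ^ 2 := by rw [hR]; linear_combination 2 * hrr
    have h3 : (r ^ 2)⁻¹ * T ≥ 1 := by
      rw [ge_iff_le, inv_mul_eq_div, le_div_iff₀ (by positivity)]; linarith
    have h4 : T⁻¹ ≤ 1 := (inv_lt_one_of_one_lt₀ hT1).le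
    have h5 : r ^ 2 * (r⁻¹) ^ 2 = 1 := by rw [← mul_pow, hrr, one_pow]
    have h6 : T⁻¹ * r ^ 2 ≤ 1 := by
      rw [inv_mul_eq_div, div_le_one hT0]; exact hT2
    have h7 : (r⁻¹) ^ 2 ≤ 1 := pow_le_one₀ (by positivity) hri.le
    have : 0 ≤ (T - r ^ 2) * (1 - T⁻¹ * (r⁻¹) ^ 2) :=
      mul_nonneg (by linarith) (by
        have : T⁻¹ * (r⁻¹) ^ 2 ≤ 1 * 1 := by gcongr
        linarith)
    rw [h0, hS]
    have e : (T - r ^ 2) * (1 - T⁻¹ * (r⁻¹) ^ 2) =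
      T - r ^ 2 - (r⁻¹) ^ 2 * (T * T⁻¹) + T⁻¹ * (r ^ 2 * (r⁻¹) ^ 2) := by ring
    rw [e, hTT, h5] at this
    linarith
  have hfin : (S - 2) * (2 * R * a.re + S + 2) = 0 := by
    have hexp : (S * a.re + R) ^ 2 + (T - T⁻¹) ^ 2 * a.im ^ 2 = (2 * a.re + R) ^ 2 := by
      rw [hS]; linear_combination hn
    have : a.im ^ 2 = 1 - a.re ^ 2 := by linarith
    rw [this] at hexp
    linear_combination hexp + (1 - a.re ^ 2) * hSS
  have hre : -1 ≤ a.re := by nlinarith [sq_nonneg a.im]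
  have : 0 < (S - 2) * (2 * R * a.re + S + 2) := by
    apply mul_pos <;> nlinarith
  linarith

lemma edgePoly_ratio_bound {κ B₀ B₁ : ℝ} (hκ0 : 0 ≤ κ) (hκ1 : κ < 1) (hB : 1 < B₀) {b : ℂ}
    (hb0 : B₀ ≤ ‖b‖) (hb1 : ‖b‖ ≤ B₁) {m : ℕ} (hm : 3 ≤ B₀ ^ m * (1 - κ)) :
    (edgePoly κ m).eval (b + b⁻¹) ≠ 0 ∧
    ‖(edgePoly κ (m + 1)).eval (b + b⁻¹) / (edgePoly κ m).eval (b + b⁻¹) - b‖ ≤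
      2 * (B₁ + 1) * B₀⁻¹ ^ m := by
  have hbn : 0 < ‖b‖ := by linarith
  have hb : b ≠ 0 := norm_pos_iff.1 hbn
  have h1 := edgePoly_eval_closed κ hb m
  have h2 := edgePoly_eval_succ_sub κ hb m
  set P := (edgePoly κ m).eval (b + b⁻¹)
  set P' := (edgePoly κ (m + 1)).eval (b + b⁻¹)
  have hκn : ‖(κ : ℂ)‖ = κ := by simp [abs_of_nonneg hκ0]
  have hinv1 : ‖b⁻¹‖ ≤ 1 := by rw [norm_inv]; exact inv_le_one_of_one_le₀ (by linarith)
  have hlow : 1 ≤ ‖P‖ * ‖b - b⁻¹‖ := by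
    rw [← norm_mul, h1]
    have e1 : B₀ ^ m * (1 - κ) ≤ ‖b ^ m * (b + κ)‖ := by
      rw [norm_mul, norm_pow]
      have : 1 - κ ≤ ‖b + κ‖ := by
        have := norm_sub_le (b + κ) κ
        rw [add_sub_cancel_right, hκn] at this
        linarith
      gcongr
    have e2 : ‖b⁻¹ ^ m * (b⁻¹ + κ)‖ ≤ 2 := by
      rw [norm_mul, norm_pow]
      have : ‖b⁻¹ + κ‖ ≤ 2 := (norm_add_le _ _).trans (by rw [hκn]; linarith)
      calc _ ≤ 1 * (2 : ℝ) := by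
            gcongr
            exact pow_le_one₀ (norm_nonneg _) hinv1
        _ = 2 := one_mul _
    have := norm_sub_norm_le (b ^ m * (b + κ)) (b⁻¹ ^ m * (b⁻¹ + κ))
    linarith
  have hd : ‖b - b⁻¹‖ ≤ B₁ + 1 := (norm_sub_le _ _).trans (by linarith)
  have hP : P ≠ 0 := by
    intro h
    rw [h, norm_zero, zero_mul] at hlow
    linarith
  refine ⟨hP, ?_⟩
  rw [div_sub' hP, mul_comm P b, h2, norm_div, norm_mul, norm_pow,
    div_le_iff₀ (norm_pos_iff.2 hP)]
  have e3 : ‖b⁻¹‖ ≤ B₀⁻¹ := by rw [norm_inv]; gcongr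
  have e4 : ‖b⁻¹ + κ‖ ≤ 2 := (norm_add_le _ _).trans (by rw [hκn]; linarith)
  have e5 : 1 ≤ ‖P‖ * (B₁ + 1) := hlow.trans (by gcongr)
  have hB0 : 0 < B₀ := by linarith
  calc ‖b⁻¹‖ ^ m * ‖b⁻¹ + κ‖ ≤ B₀⁻¹ ^ m * 2 := by gcongr
    _ ≤ (B₀⁻¹ ^ m * 2) * (‖P‖ * (B₁ + 1)) := le_mul_of_one_le_right (by positivity) e5
    _ = _ := by ring

lemma exists_fixedPoint_of_bounded_on_strip {f : ℂ → ℂ} {δ M L : ℝ} (hδ : 0 < δ) (hL : 0 < L)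
    (hd : ∀ k : ℂ, |k.im| < δ → DifferentiableAt ℂ f k)
    (hb : ∀ k : ℂ, |k.im| < δ → ‖f k‖ ≤ M) (hM : 8 * M ≤ L * δ) (c : ℝ) :
    ∃ k : ℂ, |k.im| < δ ∧ Complex.I * (L * k) = Complex.I * c + f k := by
  have hM0 : 0 ≤ M := (norm_nonneg _).trans (hb 0 (by simpa using hδ))
  set s : Set ℂ := {k | |k.im| ≤ δ / 2} with hs
  have hsc : IsClosed s := isClosed_le (by fun_prop) (by fun_prop)
  have hconv : Convex ℝ s := by
    have : s = Complex.imCLM ⁻¹' (Set.Icc (-(δ / 2)) (δ / 2)) := by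
      ext k; simp [hs, abs_le]
    rw [this]
    exact (convex_Icc _ _).is_linear_preimage Complex.imCLM.isBoundedLinearMap.toIsLinearMap
  have hderiv : ∀ k ∈ s, ‖deriv f k‖ ≤ M / (δ / 4) := by
    intro k hk
    have hin : ∀ w ∈ Metric.closedBall k (δ / 4), |w.im| < δ := by
      intro w hw
      have h1 := (Complex.abs_im_le_norm (w - k)).trans (mem_closedBall_iff_norm.1 hw)
      rw [Complex.sub_im] at h1
      have h2 : |k.im| ≤ δ / 2 := hk
      have h3 := abs_sub_abs_le_abs_sub w.im k.im
      linarith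
    apply Complex.norm_deriv_le_of_forall_mem_sphere_norm_le (by positivity)
    · apply DifferentiableOn.diffContOnCl
      intro w hw
      rw [closure_ball _ (by positivity)] at hw
      exact (hd w (hin w hw)).differentiableWithinAt
    · intro w hw
      exact hb w (hin w (Metric.sphere_subset_closedBall hw))
  have hlip : ∀ x ∈ s, ∀ y ∈ s, ‖f y - f x‖ ≤ M / (δ / 4) * ‖y - x‖ := fun x hx y hy =>
    hconv.norm_image_sub_le_of_norm_deriv_le
      (fun k hk => hd k (lt_of_le_of_lt hk (by linarith))) hderiv hx hy
  set g : ℂ → ℂ := fun k => (c - Complex.I * f k) / L with hg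
  have hLn : ‖(L : ℂ)‖ = L := by simp [abs_of_pos hL]
  have hmaps : Set.MapsTo g s s := by
    intro k hk
    have hfk := hb k (lt_of_le_of_lt hk (by linarith))
    have : (g k).im = -(f k).re / L := by
      rw [hg]; simp only [Complex.div_ofReal_im]; simp
    change |(g k).im| ≤ δ / 2
    rw [this, abs_div, abs_neg, abs_of_pos hL, div_le_iff₀ hL]
    have := (Complex.abs_re_le_norm (f k)).trans hfk
    nlinarith
  have hcontr : ContractingWith (1 / 2 : NNReal) (hmaps.restrict g s s) := by
    refine ⟨by norm_num [← NNReal.coe_lt_coe], LipschitzWith.of_dist_le_mul ?_⟩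
    rintro ⟨x, hx⟩ ⟨y, hy⟩
    rw [Subtype.dist_eq, Subtype.dist_eq, Set.MapsTo.val_restrict_apply,
      Set.MapsTo.val_restrict_apply, dist_eq_norm, dist_eq_norm]
    have e : g x - g y = -Complex.I * (f x - f y) / L := by rw [hg]; ring
    rw [e, norm_div, norm_mul, norm_neg, Complex.norm_I, one_mul, hLn, div_le_iff₀ hL]
    refine (hlip y hy x hx).trans ?_
    have : M / (δ / 4) ≤ 1 / 2 * L := by
      rw [div_le_iff₀ (by positivity)]; linarith
    have h2 := mul_le_mul_of_nonneg_right this (norm_nonneg (x - y))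
    push_cast
    linarith
  obtain ⟨k, hk, hfix, -⟩ := hcontr.exists_fixedPoint' hsc.isComplete hmaps
    (show (0 : ℂ) ∈ s by simp [hs]; positivity) (edist_ne_top _ _)
  refine ⟨k, lt_of_le_of_lt hk (by linarith), ?_⟩
  have hLc : (L : ℂ) ≠ 0 := by exact_mod_cast hL.ne'
  have hk2 : (L : ℂ) * k = c - Complex.I * f k := by
    conv_lhs => rw [← hfix.eq]
    rw [hg]; field_simp
  rw [hk2]
  linear_combination (-f k) * Complex.I_sq

/-- The rescaled spectral parameter for which the left half chain has Floquet multipliers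
`a, a⁻¹`. -/
def bandPt (θ r : ℝ) (a : ℂ) : ℂ :=
  Complex.exp (Complex.I * θ) * (a + a⁻¹ + (r + (r : ℂ)⁻¹))

/-- The value `2 μ` of the right half chain at the spectral parameter `bandPt θ r a`. -/
def bandArg (θ r : ℝ) (a : ℂ) : ℂ :=
  Complex.exp (Complex.I * θ) * bandPt θ r a - (r + (r : ℂ)⁻¹)

/-- Boundary impedance of the right half chain. -/
def edgeRatio (θ r : ℝ) (m : ℕ) (a : ℂ) : ℂ :=
  (edgePoly (r : ℂ)⁻¹ (m + 1)).eval (bandArg θ r a) / (edgePoly (r : ℂ)⁻¹ m).eval (bandArg θ r a)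
    / (r : ℂ) ^ 2

lemma bandPt_inv (θ r : ℝ) (a : ℂ) : bandPt θ r a⁻¹ = bandPt θ r a := by
  rw [bandPt, bandPt, inv_inv, add_comm a⁻¹ a]

lemma edgeRatio_inv (θ r : ℝ) (m : ℕ) (a : ℂ) : edgeRatio θ r m a⁻¹ = edgeRatio θ r m a := by
  rw [edgeRatio, edgeRatio, bandArg, bandPt_inv]; rfl

lemma differentiableAt_bandArg (θ r : ℝ) {a : ℂ} (ha : a ≠ 0) :
    DifferentiableAt ℂ (bandArg θ r) a := by
  unfold bandArg bandPt
  fun_prop (disch := exact ha)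

lemma add_inv_of_norm_eq_one {a : ℂ} (ha : ‖a‖ = 1) : a + a⁻¹ = ((2 * a.re : ℝ) : ℂ) := by
  rw [Complex.inv_def, Complex.normSq_eq_norm_sq, ha, inv_eq_one_div]
  simp [Complex.add_conj]

lemma abs_re_le_one_of_norm_eq_one {a : ℂ} (ha : ‖a‖ = 1) : a.re ∈ Set.Icc (-1 : ℝ) 1 := by
  have := Complex.abs_re_le_norm a
  rw [ha] at this
  exact abs_le.1 this

lemma two_lt_add_inv {r : ℝ} (hr : 1 < r) : 2 < r + r⁻¹ := by
  have hr0 : 0 < r := by linarith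
  have : r + r⁻¹ - 2 = (r - 1) ^ 2 / r := by field_simp; ring
  have : 0 < (r - 1) ^ 2 / r := by
    have : 0 < r - 1 := by linarith
    positivity
  linarith

lemma bandPt_of_norm_eq_one (θ r : ℝ) {a : ℂ} (ha : ‖a‖ = 1) :
    bandPt θ r a = Complex.exp (Complex.I * θ) * ((2 * a.re + (r + r⁻¹) : ℝ) : ℂ) := by
  rw [bandPt, add_inv_of_norm_eq_one ha]; push_cast; rfl

lemma bandArg_im_pos {θ r : ℝ} (h0 : 0 < θ) (h1 : θ < Real.pi / 2) (hr : 1 < r) {a : ℂ}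
    (ha : ‖a‖ = 1) : 0 < (bandArg θ r a).im := by
  have e : Complex.exp (Complex.I * θ) * Complex.exp (Complex.I * θ) =
      Complex.exp ((2 * θ : ℝ) * Complex.I) := by
    rw [← Complex.exp_add]; congr 1; push_cast; ring
  rw [bandArg, bandPt_of_norm_eq_one θ r ha, ← mul_assoc, e,
    show (r : ℂ) + (r : ℂ)⁻¹ = ((r + r⁻¹ : ℝ) : ℂ) by push_cast; rfl, Complex.sub_im,
    Complex.im_mul_ofReal, Complex.exp_ofReal_mul_I_im, Complex.ofReal_im, sub_zero]
  have := two_lt_add_inv hr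
  have := (abs_re_le_one_of_norm_eq_one ha).1
  exact mul_pos (Real.sin_pos_of_pos_of_lt_pi (by linarith) (by linarith)) (by linarith)

/-- Uniform control of the boundary impedance on an annulus around the unit circle. -/
lemma exists_annulus_control {θ r : ℝ} (h0 : 0 < θ) (h1 : θ < Real.pi / 2) (hr : 1 < r)
    {O : Set ℂ} (hO : IsOpen O)
    (hband : ∀ c ∈ Set.Icc (-1 : ℝ) 1,
      Complex.exp (Complex.I * θ) * ((2 * c + (r + r⁻¹) : ℝ) : ℂ) ∈ O) :
    ∃ δ > 0, ∃ M : ℝ, ∃ m₀ : ℕ, ∀ m ≥ m₀, ∀ a ∈ Metric.cthickening δ (Metric.sphere (0 : ℂ) 1),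
      a ≠ 0 ∧ bandPt θ r a ∈ O ∧ (edgePoly (r : ℂ)⁻¹ m).eval (bandArg θ r a) ≠ 0 ∧
      1 + (r : ℂ)⁻¹ * a ∈ Complex.slitPlane ∧ 1 - edgeRatio θ r m a * a ∈ Complex.slitPlane ∧
      ‖Complex.log (1 + (r : ℂ)⁻¹ * a)‖ ≤ M ∧ ‖Complex.log (1 - edgeRatio θ r m a * a)‖ ≤ M := by
  have hr0 : 0 < r := by linarith
  have hrc : (r : ℂ) ≠ 0 := by exact_mod_cast hr0.ne'
  set b : ℂ → ℂ := fun a => upperRoot (bandArg θ r a) with hbdef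
  set F : ℂ → ℂ := fun a => 1 - a * b a / (r : ℂ) ^ 2 with hF
  have hbcont : ∀ a : ℂ, a ≠ 0 → 0 < (bandArg θ r a).im → ContinuousAt b a := fun a ha hy =>
    ContinuousAt.comp (g := upperRoot) (continuousAt_upperRoot hy)
      (differentiableAt_bandArg θ r ha).continuousAt
  have hFcont : ∀ a : ℂ, a ≠ 0 → 0 < (bandArg θ r a).im → ContinuousAt F a := fun a ha hy => by
    have := hbcont a ha hy
    fun_prop
  set U : Set ℂ := {a | ∀ᶠ z in 𝓝 a, z ≠ 0 ∧ 0 < (bandArg θ r z).im ∧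
    F z ∈ Complex.slitPlane ∧ 1 + (r : ℂ)⁻¹ * z ∈ Complex.slitPlane ∧ bandPt θ r z ∈ O} with hU
  have hUo : IsOpen U := isOpen_setOfPred_eventually_nhds
  have hSU : Metric.sphere (0 : ℂ) 1 ⊆ U := by
    intro a ha
    have ha1 : ‖a‖ = 1 := by simpa using ha
    have ha0 : a ≠ 0 := fun h => by simp [h] at ha1
    have him := bandArg_im_pos h0 h1 hr ha1
    have hyc := (differentiableAt_bandArg θ r ha0).continuousAt
    have hspec := upperRoot_spec him
    refine Filter.Eventually.and (isOpen_ne.mem_nhds ha0) (.and ?_ (.and ?_ (.and ?_ ?_)))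
    · exact (Complex.continuous_im.continuousAt.comp hyc).eventually (lt_mem_nhds him)
    · refine (hFcont a ha0 him).eventually (Complex.isOpen_slitPlane.mem_nhds ?_)
      refine one_sub_mem_slitPlane_of_norm_eq hr ha1
        (u := Complex.exp (Complex.I * θ) * Complex.exp (Complex.I * θ)) ?_ ?_
      · rw [norm_mul, mul_comm Complex.I, Complex.norm_exp_ofReal_mul_I, one_mul]
      · change upperRoot _ + (upperRoot _)⁻¹ + _ = _
        rw [hspec.2, bandArg, bandPt]; ring
    · refine (by fun_prop : Continuous fun z : ℂ => 1 + (r : ℂ)⁻¹ * z).continuousAt.eventually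
        (Complex.isOpen_slitPlane.mem_nhds (Complex.mem_slitPlane_of_norm_lt_one ?_))
      rw [norm_mul, ha1, norm_inv, Complex.norm_real, Real.norm_of_nonneg hr0.le, mul_one]
      exact inv_lt_one_of_one_lt₀ hr
    · have hc : ContinuousAt (bandPt θ r) a := by
        unfold bandPt
        fun_prop (disch := exact ha0)
      refine hc.eventually (hO.mem_nhds ?_)
      rw [bandPt_of_norm_eq_one θ r ha1]
      exact hband _ (abs_re_le_one_of_norm_eq_one ha1)
  obtain ⟨δ, hδ, hQU⟩ := (isCompact_sphere (0 : ℂ) 1).exists_cthickening_subset_open hUo hSU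
  set Q := Metric.cthickening δ (Metric.sphere (0 : ℂ) 1) with hQ
  have hQc : IsCompact Q := (isCompact_sphere (0 : ℂ) 1).cthickening
  have hQp : ∀ a ∈ Q, a ≠ 0 ∧ 0 < (bandArg θ r a).im ∧ F a ∈ Complex.slitPlane ∧
      1 + (r : ℂ)⁻¹ * a ∈ Complex.slitPlane ∧ bandPt θ r a ∈ O := fun a ha =>
    (hQU ha : ∀ᶠ z in 𝓝 a, _).self_of_nhds
  have hbQ : ContinuousOn b Q := fun a ha =>
    (hbcont a (hQp a ha).1 (hQp a ha).2.1).continuousWithinAt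
  have hFQ : ContinuousOn F Q := fun a ha =>
    (hFcont a (hQp a ha).1 (hQp a ha).2.1).continuousWithinAt
  have hQne : Q.Nonempty := ⟨1, Metric.self_subset_cthickening _ (by simp)⟩
  obtain ⟨a₀, ha₀, hmin⟩ := hQc.exists_isMinOn hQne hbQ.norm
  obtain ⟨B₁, hB₁⟩ := hQc.exists_bound_of_continuousOn hbQ
  obtain ⟨A, hA⟩ := hQc.exists_bound_of_continuousOn (f := fun z : ℂ => z) continuousOn_id
  have hT0 : IsCompact (F '' Q) := hQc.image_of_continuousOn hFQ
  obtain ⟨d, hd, hT⟩ := hT0.exists_cthickening_subset_open Complex.isOpen_slitPlane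
    (by rintro _ ⟨a, ha, rfl⟩; exact (hQp a ha).2.2.1)
  obtain ⟨M₁, hM₁⟩ := hT0.cthickening (r := d) |>.exists_bound_of_continuousOn
    (f := Complex.log) (fun z hz => (continuousAt_clog (hT hz)).continuousWithinAt)
  obtain ⟨M₂, hM₂⟩ := hQc.exists_bound_of_continuousOn
    (f := fun z : ℂ => Complex.log (1 + (r : ℂ)⁻¹ * z)) (fun z hz =>
      ((by fun_prop : ContinuousAt (fun z : ℂ => 1 + (r : ℂ)⁻¹ * z) z).clog
        (hQp z hz).2.2.2.1).continuousWithinAt)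
  set B₀ := ‖b a₀‖ with hB₀
  have hB₀1 : 1 < B₀ := (upperRoot_spec (hQp a₀ ha₀).2.1).1
  have hri : r⁻¹ < 1 := inv_lt_one_of_one_lt₀ hr
  have hlim1 : Tendsto (fun m : ℕ => B₀ ^ m * (1 - r⁻¹)) atTop atTop :=
    (tendsto_pow_atTop_atTop_of_one_lt hB₀1).atTop_mul_const (by linarith)
  have hlim2 : Tendsto (fun m : ℕ => A * (2 * (B₁ + 1) * B₀⁻¹ ^ m)) atTop (𝓝 0) := by
    have := tendsto_pow_atTop_nhds_zero_of_lt_one (r := B₀⁻¹) (by positivity)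
      (inv_lt_one_of_one_lt₀ hB₀1)
    simpa using (this.const_mul (2 * (B₁ + 1))).const_mul A
  obtain ⟨m₀, hm₀⟩ := eventually_atTop.1
    ((hlim1.eventually_ge_atTop 3).and (hlim2.eventually (ge_mem_nhds hd)))
  refine ⟨δ, hδ, max M₁ M₂, m₀, fun m hm a ha => ?_⟩
  obtain ⟨p1, p2, p3, p4, p5⟩ := hQp a ha
  have hspec := upperRoot_spec p2
  have hbd := edgePoly_ratio_bound (κ := r⁻¹) (by positivity) hri hB₀1 (b := b a) (hmin ha)
    (hB₁ a ha) (hm₀ m hm).1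
  rw [show b a + (b a)⁻¹ = bandArg θ r a from hspec.2] at hbd
  push_cast at hbd
  have hmem : 1 - edgeRatio θ r m a * a ∈ Metric.cthickening d (F '' Q) := by
    refine Metric.mem_cthickening_of_dist_le _ (F a) _ _ ⟨a, ha, rfl⟩ ?_
    have e : 1 - edgeRatio θ r m a * a - F a = -(a * ((edgePoly (r : ℂ)⁻¹ (m + 1)).eval
        (bandArg θ r a) / (edgePoly (r : ℂ)⁻¹ m).eval (bandArg θ r a) - b a)) / (r : ℂ) ^ 2 := by
      rw [hF, edgeRatio]; ring
    have hA0 : 0 ≤ A := (norm_nonneg _).trans (hA a ha)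
    rw [dist_eq_norm, e, norm_div, norm_neg, norm_mul]
    refine (div_le_self (by positivity) ?_).trans ?_
    · rw [norm_pow, Complex.norm_real, Real.norm_of_nonneg hr0.le]
      exact one_le_pow₀ hr.le
    · exact (mul_le_mul (hA a ha) hbd.2 (norm_nonneg _) hA0).trans (hm₀ m hm).2
  exact ⟨p1, p5, hbd.1, p4, hT hmem, (hM₂ a ha).trans (le_max_right _ _),
    (hM₁ _ hmem).trans (le_max_left _ _)⟩

/-- Quantisation condition: the secular polynomial vanishes at `bandPt θ r a`. -/
lemma secPoly_eval_bandPt {θ r : ℝ} {m : ℕ} {a : ℂ} (hr : r ≠ 0) (ha : a ≠ 0) (ha2 : a - a⁻¹ ≠ 0)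
    (hP : (edgePoly (r : ℂ)⁻¹ m).eval (bandArg θ r a) ≠ 0)
    (h : a ^ (m + 1) * ((1 + (r : ℂ)⁻¹ * a⁻¹) * (1 - edgeRatio θ r m a * a)) =
      a⁻¹ ^ (m + 1) * ((1 + (r : ℂ)⁻¹ * a) * (1 - edgeRatio θ r m a * a⁻¹))) :
    (secPoly θ r m).eval (bandPt θ r a) = 0 := by
  have hrc : (r : ℂ) ≠ 0 := by exact_mod_cast hr
  have hx : Complex.exp (-(Complex.I * θ)) * bandPt θ r a - (r + (r : ℂ)⁻¹) = a + a⁻¹ := by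
    rw [bandPt, ← mul_assoc, ← Complex.exp_add]; simp
  rw [secPoly_eval, hx]
  change _ * (edgePoly (r : ℂ)⁻¹ (m + 1)).eval (bandArg θ r a) -
    (r : ℂ) ^ 2 * (_ * (edgePoly (r : ℂ)⁻¹ m).eval (bandArg θ r a)) = 0
  have hG : (edgePoly (r : ℂ)⁻¹ (m + 1)).eval (bandArg θ r a) =
      edgeRatio θ r m a * (r ^ 2 * (edgePoly (r : ℂ)⁻¹ m).eval (bandArg θ r a)) := by
    rw [edgeRatio, ← mul_assoc, div_mul_cancel₀ _ (pow_ne_zero 2 hrc), div_mul_cancel₀ _ hP]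
  have c1 := edgePoly_eval_closed (r : ℂ)⁻¹ ha (m + 1)
  have c2 := edgePoly_eval_closed (r : ℂ)⁻¹ ha m
  rw [hG]
  generalize edgeRatio θ r m a = G at *
  generalize (edgePoly (r : ℂ)⁻¹ m).eval (bandArg θ r a) = q at *
  have key : (a - a⁻¹) * ((edgePoly (r : ℂ)⁻¹ (m + 1)).eval (a + a⁻¹) * G -
      (edgePoly (r : ℂ)⁻¹ m).eval (a + a⁻¹)) = 0 := by
    have haa : a * a⁻¹ = 1 := mul_inv_cancel₀ ha
    generalize a⁻¹ = d at *
    generalize (r : ℂ)⁻¹ = k at *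
    rw [pow_succ, pow_succ] at h c1
    linear_combination G * c1 - c2 - h + (a ^ m * k - a ^ m * k * G * a - d ^ m * k
      + d ^ m * k * G * d) * haa
  have := (mul_eq_zero.1 key).resolve_left ha2
  linear_combination (r : ℂ) ^ 2 * q * this

lemma eq_or_eq_inv_of_add_inv_eq {a b : ℂ} (ha : a ≠ 0) (hb : b ≠ 0) (h : a + a⁻¹ = b + b⁻¹) :
    a = b ∨ a = b⁻¹ := by
  have : (a - b) * (a - b⁻¹) = 0 := by
    have h1 : a * a⁻¹ = 1 := mul_inv_cancel₀ ha
    have h2 : b * b⁻¹ = 1 := mul_inv_cancel₀ hb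
    linear_combination a * h - h1 + h2
  rcases mul_eq_zero.1 this with h | h
  · exact .inl (sub_eq_zero.1 h)
  · exact .inr (sub_eq_zero.1 h)

lemma exp_I_mul_mem_cthickening {δ : ℝ} {k : ℂ} (hk : |Real.exp (-k.im) - 1| ≤ δ) :
    Complex.exp (Complex.I * k) ∈ Metric.cthickening δ (Metric.sphere (0 : ℂ) 1) := by
  refine Metric.mem_cthickening_of_dist_le _ (Complex.exp (k.re * Complex.I)) _ _ ?_ ?_
  · simp [Complex.norm_exp_ofReal_mul_I]
  · have : Complex.exp (Complex.I * k) - Complex.exp (k.re * Complex.I) =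
        ((Real.exp (-k.im) - 1 : ℝ) : ℂ) * Complex.exp (k.re * Complex.I) := by
      have e : Complex.I * k = ((-k.im : ℝ) : ℂ) + k.re * Complex.I := by
        conv_lhs => rw [← Complex.re_add_im k]
        push_cast
        linear_combination (k.im : ℂ) * Complex.I_sq
      rw [e, Complex.exp_add]
      push_cast; ring
    rw [dist_eq_norm, this, norm_mul, Complex.norm_exp_ofReal_mul_I, mul_one, Complex.norm_real]
    exact hk

/-- The secular polynomial has `m` distinct roots near the band of the left half chain. -/
lemma exists_secPoly_roots_near_band {θ r : ℝ} (h0 : 0 < θ) (h1 : θ < Real.pi / 2) (hr : 1 < r)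
    {O : Set ℂ} (hO : IsOpen O)
    (hband : ∀ c ∈ Set.Icc (-1 : ℝ) 1,
      Complex.exp (Complex.I * θ) * ((2 * c + (r + r⁻¹) : ℝ) : ℂ) ∈ O) :
    ∃ m₀ : ℕ, ∀ m ≥ m₀, ∃ S : Finset ℂ, S.card = m ∧
      ∀ t ∈ S, t ∈ O ∧ (secPoly θ r m).eval t = 0 := by
  obtain ⟨δ', hδ', M, m₀, hctl⟩ := exists_annulus_control h0 h1 hr hO hband
  obtain ⟨δ, hδ, hδδ⟩ : ∃ δ > 0, ∀ u : ℝ, |u| < δ → |Real.exp u - 1| ≤ δ' := by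
    have hc : ContinuousAt (fun u : ℝ => |Real.exp u - 1|) 0 := by fun_prop
    have := hc.eventually (ge_mem_nhds (show |Real.exp 0 - 1| < δ' by simpa using hδ'))
    obtain ⟨δ, hδ, h⟩ := Metric.eventually_nhds_iff.1 this
    exact ⟨δ, hδ, fun u hu => h (by simpa [Real.dist_eq] using hu)⟩
  have hann : ∀ k : ℂ, |k.im| < δ → Complex.exp (Complex.I * k) ∈
      Metric.cthickening δ' (Metric.sphere (0 : ℂ) 1) := fun k hk =>
    exp_I_mul_mem_cthickening (hδδ _ (by rwa [abs_neg]))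
  have hinv : ∀ k : ℂ, Complex.exp (Complex.I * (-k)) = (Complex.exp (Complex.I * k))⁻¹ :=
    fun k => by rw [mul_neg, Complex.exp_neg]
  obtain ⟨m₁, hm₁⟩ := exists_nat_ge (8 * (4 * M) / δ)
  refine ⟨max m₀ m₁, fun m hm => ?_⟩
  replace hctl := hctl m ((le_max_left _ _).trans hm)
  have hm1 : (m₁ : ℝ) ≤ m := by exact_mod_cast (le_max_right _ _).trans hm
  set H : ℂ → ℂ := fun a => Complex.log (1 + (r : ℂ)⁻¹ * a) -
    Complex.log (1 - edgeRatio θ r m a * a) with hH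
  set f : ℂ → ℂ := fun k => H (Complex.exp (Complex.I * k)) - H (Complex.exp (Complex.I * (-k)))
    with hf
  have hHd : ∀ a ∈ Metric.cthickening δ' (Metric.sphere (0 : ℂ) 1), DifferentiableAt ℂ H a := by
    intro a ha
    obtain ⟨q1, -, q3, q4, q5, -, -⟩ := hctl a ha
    have hy := differentiableAt_bandArg θ r q1
    have hG : DifferentiableAt ℂ (edgeRatio θ r m) a := by
      have hp : ∀ n, DifferentiableAt ℂ (fun z => (edgePoly (r : ℂ)⁻¹ n).eval (bandArg θ r z)) a :=
        fun n => DifferentiableAt.comp (g := fun y => (edgePoly (r : ℂ)⁻¹ n).eval y)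
          (f := bandArg θ r) a (edgePoly (r : ℂ)⁻¹ n).differentiableAt hy
      exact ((hp (m + 1)).fun_div (hp m) q3).div_const _
    refine DifferentiableAt.sub (DifferentiableAt.clog (by fun_prop) q4)
      (DifferentiableAt.clog (by fun_prop) q5)
  have hfix := fun j : ℕ => exists_fixedPoint_of_bounded_on_strip (f := f) (δ := δ) (M := 4 * M)
    (L := 2 * (m + 1 : ℝ)) hδ (by positivity)
    (fun k hk => by
      have g1 := hHd _ (hann k hk)
      have g2 := hHd _ (hann (-k) (by simpa using hk))
      refine DifferentiableAt.sub ?_ ?_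
      · exact DifferentiableAt.comp (g := H) (f := fun k => Complex.exp (Complex.I * k))
          k g1 (by fun_prop)
      · exact DifferentiableAt.comp (g := H) (f := fun k => Complex.exp (Complex.I * (-k)))
          k g2 (by fun_prop))
    (fun k hk => by
      obtain ⟨-, -, -, -, -, q6, q7⟩ := hctl _ (hann k hk)
      obtain ⟨-, -, -, -, -, q8, q9⟩ := hctl _ (hann (-k) (by simpa using hk))
      refine (norm_sub_le _ _).trans ((add_le_add (norm_sub_le _ _) (norm_sub_le _ _)).trans ?_)
      linarith)
    (by
      rw [div_le_iff₀ hδ] at hm₁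
      have : (m₁ : ℝ) * δ ≤ 2 * (m + 1) * δ := by gcongr; linarith
      linarith)
    (2 * Real.pi * j)
  choose k hk hkeq using hfix
  set a : ℕ → ℂ := fun j => Complex.exp (Complex.I * k j) with ha
  have ha0 : ∀ j, a j ≠ 0 := fun j => Complex.exp_ne_zero _
  have hfk : ∀ j, f (k j) = H (a j) - H (a j)⁻¹ := fun j => by rw [hf, ha]; simp only [hinv]
  have hpi : (2 * Real.pi * Complex.I : ℂ) ≠ 0 := Complex.two_pi_I_ne_zero
  have hkeq' : ∀ j, Complex.I * (2 * (m + 1) * k j) =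
      j * (2 * Real.pi * Complex.I) + (H (a j) - H (a j)⁻¹) := by
    intro j
    have := hkeq j
    rw [hfk] at this
    push_cast at this
    linear_combination this
  -- symmetric multipliers force an arithmetic relation between the quantum numbers
  have hrefl : ∀ i j : ℕ, a i = (a j)⁻¹ → ∃ n : ℤ, (i + j : ℤ) = 2 * (m + 1) * n := by
    intro i j h
    have h' : Complex.exp (Complex.I * k i) = Complex.exp (-(Complex.I * k j)) := by
      rw [Complex.exp_neg]; exact h
    obtain ⟨n, hn⟩ := Complex.exp_eq_exp_iff_exists_int.1 h'
    refine ⟨n, ?_⟩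
    have e1 := hkeq' i
    have e2 := hkeq' j
    rw [h, inv_inv] at e1
    have : ((i : ℂ) + j) * (2 * Real.pi * Complex.I) =
        2 * (m + 1) * n * (2 * Real.pi * Complex.I) := by
      linear_combination -e1 - e2 + 2 * (m + 1) * hn
    exact_mod_cast mul_right_cancel₀ hpi this
  have hne : ∀ i ∈ Finset.Icc 1 m, ∀ j ∈ Finset.Icc 1 m, a i ≠ (a j)⁻¹ := by
    intro i hi j hj h
    obtain ⟨n, hn⟩ := hrefl i j h
    rw [Finset.mem_Icc] at hi hj
    have hn0 : 0 < n := by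
      by_contra hle
      nlinarith
    nlinarith
  have hinj : Set.InjOn (fun j => bandPt θ r (a j)) (Finset.Icc 1 m : Finset ℕ) := by
    intro i hi j hj h
    have hs : a i + (a i)⁻¹ = a j + (a j)⁻¹ :=
      add_right_cancel (mul_left_cancel₀ (Complex.exp_ne_zero _) h)
    rcases eq_or_eq_inv_of_add_inv_eq (ha0 i) (ha0 j) hs with h | h
    · obtain ⟨n, hn⟩ := Complex.exp_eq_exp_iff_exists_int.1 (show Complex.exp _ = Complex.exp _
        from h)
      have e1 := hkeq' i
      have e2 := hkeq' j
      rw [h] at e1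
      have : ((i : ℂ) - j) * (2 * Real.pi * Complex.I) =
          2 * (m + 1) * n * (2 * Real.pi * Complex.I) := by
        linear_combination -e1 + e2 + 2 * (m + 1) * hn
      have h3 : (i - j : ℤ) = 2 * (m + 1) * n := by exact_mod_cast mul_right_cancel₀ hpi this
      have hi' := Finset.mem_Icc.1 hi
      have hj' := Finset.mem_Icc.1 hj
      have : n = 0 := by
        by_contra hn0
        rcases lt_or_gt_of_ne hn0 with hlt | hlt <;> nlinarith
      rw [this] at h3
      omega
    · exact (hne i hi j hj h).elim
  refine ⟨(Finset.Icc 1 m).image fun j => bandPt θ r (a j), ?_, ?_⟩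
  · rw [Finset.card_image_of_injOn hinj]; simp
  intro t ht
  obtain ⟨j, hj, rfl⟩ := Finset.mem_image.1 ht
  obtain ⟨-, q2, q3, q4, q5, -, -⟩ := hctl _ (hann (k j) (hk j))
  obtain ⟨-, -, -, q8, q9, -, -⟩ := hctl _ (hann (-(k j)) (by simpa using hk j))
  rw [hinv] at q8 q9
  refine ⟨q2, secPoly_eval_bandPt (by linarith) (ha0 j)
    (fun h => hne j hj j hj (sub_eq_zero.1 h)) q3 ?_⟩
  have hexp : a j ^ (2 * (m + 1)) = Complex.exp (H (a j) - H (a j)⁻¹) := by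
    have := congrArg Complex.exp (hkeq' j)
    rw [Complex.exp_add, Complex.exp_nat_mul_two_pi_mul_I, one_mul] at this
    rw [← this, ← Complex.exp_nat_mul]
    congr 1; push_cast; ring
  have n5 := Complex.slitPlane_ne_zero q5
  have n8 := Complex.slitPlane_ne_zero q8
  simp only [hH] at hexp
  rw [Complex.exp_sub, Complex.exp_sub, Complex.exp_sub, Complex.exp_log n8,
    Complex.exp_log n5, Complex.exp_log (Complex.slitPlane_ne_zero q9),
    Complex.exp_log (Complex.slitPlane_ne_zero q4)] at hexp
  have n9 := Complex.slitPlane_ne_zero q9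
  change (1 : ℂ) - edgeRatio θ r m (a j) * a j ≠ 0 at n5
  change (1 : ℂ) + (r : ℂ)⁻¹ * (a j)⁻¹ ≠ 0 at n8
  change (1 : ℂ) - edgeRatio θ r m (a j)⁻¹ * (a j)⁻¹ ≠ 0 at n9
  rw [edgeRatio_inv] at hexp n9
  rw [div_div_div_eq, eq_div_iff (mul_ne_zero n5 n8), two_mul, pow_add] at hexp
  rw [inv_pow, eq_inv_mul_iff_mul_eq₀ (pow_ne_zero _ (ha0 j))]
  linear_combination hexp

lemma cpow_half_spec (z : ℂ) : (z ^ (1 / 2 : ℂ)) ^ 2 = z ∧ 0 ≤ (z ^ (1 / 2 : ℂ)).re ∧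
    (0 ≤ z.im → 0 ≤ (z ^ (1 / 2 : ℂ)).im) ∧ (z.im < 0 → (z ^ (1 / 2 : ℂ)).im ≤ 0) := by
  by_cases hz : z = 0
  · subst hz; simp
  have hlog : (Complex.log z * (1 / 2)).im = z.arg / 2 := by
    rw [show (1 / 2 : ℂ) = ((1 / 2 : ℝ) : ℂ) by norm_num, Complex.im_mul_ofReal, Complex.log_im]
    ring
  have h1 := Complex.neg_pi_lt_arg z
  have h2 := Complex.arg_le_pi z
  refine ⟨?_, ?_, fun h => ?_, fun h => ?_⟩
  · rw [← Complex.cpow_nat_mul]; simp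
  · rw [Complex.cpow_def_of_ne_zero hz, Complex.exp_re, hlog]
    exact mul_nonneg (Real.exp_pos _).le
      (Real.cos_nonneg_of_mem_Icc ⟨by linarith, by linarith⟩)
  · rw [Complex.cpow_def_of_ne_zero hz, Complex.exp_im, hlog]
    have := Complex.arg_nonneg_iff.2 h
    exact mul_nonneg (Real.exp_pos _).le
      (Real.sin_nonneg_of_nonneg_of_le_pi (by linarith) (by linarith))
  · rw [Complex.cpow_def_of_ne_zero hz, Complex.exp_im, hlog]
    have := Complex.arg_neg_iff.2 h
    exact mul_nonpos_of_nonneg_of_nonpos (Real.exp_pos _).le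
      (Real.sin_nonpos_of_nonpos_of_neg_pi_le (by linarith) (by linarith))

lemma aMap_spec (μ : ℂ) : aMap μ ≠ 0 ∧ aMap μ + (aMap μ)⁻¹ = 2 * μ ∧ 1 ≤ ‖aMap μ‖ := by
  obtain ⟨hp, p1, p2, p3⟩ := cpow_half_spec (μ + 1)
  obtain ⟨hq, q1, q2, q3⟩ := cpow_half_spec (μ - 1)
  have hμ : aMap μ = μ + (μ + 1) ^ (1 / 2 : ℂ) * (μ - 1) ^ (1 / 2 : ℂ) := rfl
  have i1 : (μ + 1).im = μ.im := by simp
  have i2 : (μ - 1).im = μ.im := by simp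
  rw [i1] at p2 p3
  rw [i2] at q2 q3
  generalize (μ + 1) ^ (1 / 2 : ℂ) = p at *
  generalize (μ - 1) ^ (1 / 2 : ℂ) = q at *
  have hmul : aMap μ * (μ - p * q) = 1 := by
    rw [hμ]; linear_combination (-q ^ 2) * hp - (μ + 1) * hq
  have h0 : aMap μ ≠ 0 := left_ne_zero_of_mul_eq_one hmul
  have hinv : (aMap μ)⁻¹ = μ - p * q := inv_eq_of_mul_eq_one_right hmul
  refine ⟨h0, by rw [hinv, hμ]; ring, ?_⟩
  have e1 : aMap μ = (p + q) ^ 2 / 2 := by rw [hμ]; linear_combination (-1 / 2 : ℂ) * (hp + hq)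
  have e2 : (aMap μ)⁻¹ = (p - q) ^ 2 / 2 := by
    rw [hinv]; linear_combination (-1 / 2 : ℂ) * (hp + hq)
  have him : 0 ≤ p.im * q.im := by
    rcases le_or_gt 0 μ.im with h | h
    · exact mul_nonneg (p2 h) (q2 h)
    · exact mul_nonneg_of_nonpos_of_nonpos (p3 h) (q3 h)
  have hle : ‖p - q‖ ^ 2 ≤ ‖p + q‖ ^ 2 := by
    rw [← Complex.normSq_eq_norm_sq, ← Complex.normSq_eq_norm_sq, Complex.normSq_apply,
      Complex.normSq_apply]
    simp only [Complex.add_re, Complex.add_im, Complex.sub_re, Complex.sub_im]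
    nlinarith [mul_nonneg p1 q1]
  have hle2 : ‖(aMap μ)⁻¹‖ ≤ ‖aMap μ‖ := by
    rw [e2, e1, norm_div, norm_div, norm_pow, norm_pow]
    gcongr
  rw [norm_inv] at hle2
  by_contra hlt
  have h3 := norm_pos_iff.2 h0
  have := one_lt_inv_iff₀.2 ⟨h3, not_le.1 hlt⟩
  linarith

lemma aMap_eq_of_add_inv {μ a : ℂ} (h : a + a⁻¹ = 2 * μ) (ha : 1 < ‖a‖) : aMap μ = a := by
  obtain ⟨h0, h1, h2⟩ := aMap_spec μ
  have ha0 : a ≠ 0 := norm_pos_iff.1 (by linarith)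
  rcases eq_or_eq_inv_of_add_inv_eq h0 ha0 (h1.trans h.symm) with h | h
  · exact h
  · rw [h, norm_inv] at h2
    have := inv_lt_one_of_one_lt₀ ha
    linarith

lemma two_mul_muMap {γ r s : ℝ} (hc : CoeffData γ r s) (θ : ℝ) (t : ℂ) :
    2 * muMap θ γ (s * t) = Complex.exp (-(Complex.I * θ)) * t - (r + (r : ℂ)⁻¹) := by
  have hs : (s : ℂ) ≠ 0 := by exact_mod_cast hc.pos.ne'
  rw [muMap, hc.sqrt_eq, hc.alpha]
  push_cast
  field_simp

/-- The limiting equation has exactly two solutions, `0` and a positive real number. -/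
lemma exists_limiting_solutions {θ γ r s : ℝ} (h0 : 0 < θ) (h1 : θ < Real.pi / 2)
    (hc : CoeffData γ r s) :
    ∃ p : ℝ, 0 < p ∧
      {z : ℂ | aMap (muMap θ γ z) * aMap (muMap (-θ) γ z) = Complex.exp γ} = {0, (p : ℂ)} := by
  have hr1 := hc.one_lt
  have hr0 : 0 < r := by linarith
  have hrc : (r : ℂ) ≠ 0 := by exact_mod_cast hr0.ne'
  have hs : (s : ℂ) ≠ 0 := by exact_mod_cast hc.pos.ne'
  have hcos : 0 < Real.cos θ := Real.cos_pos_of_mem_Ioo ⟨by linarith, h1⟩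
  have hri : r⁻¹ < 1 := inv_lt_one_of_one_lt₀ hr1
  have hri0 : 0 < r⁻¹ := by positivity
  have hexp : Complex.exp γ = (r : ℂ) ^ 2 := by
    rw [← Complex.ofReal_exp, hc.exp_eq]; push_cast; rfl
  set e₁ := Complex.exp (Complex.I * θ) with he₁
  set e₂ := Complex.exp (-(Complex.I * θ)) with he₂
  have hee : e₁ * e₂ = 1 := by rw [he₁, he₂, ← Complex.exp_add]; simp
  have hsum : e₁ + e₂ = 2 * (Real.cos θ : ℂ) := by
    rw [he₁, he₂]; push_cast
    rw [Complex.cos, mul_comm Complex.I, neg_mul]; ring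
  have hconj : starRingEnd ℂ e₁ = e₂ := conj_exp_I_mul θ
  have hconj' : starRingEnd ℂ e₂ = e₁ := by rw [← hconj, Complex.conj_conj]
  have hx : ∀ t : ℂ, 2 * muMap θ γ (s * t) = e₂ * t - (r + (r : ℂ)⁻¹) := two_mul_muMap hc θ
  have hy : ∀ t : ℂ, 2 * muMap (-θ) γ (s * t) = e₁ * t - (r + (r : ℂ)⁻¹) := fun t => by
    rw [two_mul_muMap hc]; simp [he₁]
  obtain ⟨c, hcdef⟩ : ∃ c, c = r * e₁ - (r : ℂ)⁻¹ * e₂ := ⟨_, rfl⟩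
  obtain ⟨d, hddef⟩ : ∃ d, d = r * e₂ - (r : ℂ)⁻¹ * e₁ := ⟨_, rfl⟩
  have hcd : starRingEnd ℂ c = d := by
    rw [hcdef, hddef]; simp [hconj, hconj']
  have hn1 : ‖e₁‖ = 1 := by
    rw [he₁, mul_comm Complex.I, Complex.norm_exp_ofReal_mul_I]
  have hn2 : ‖e₂‖ = 1 := by rw [← hconj, Complex.norm_conj, hn1]
  have hcne : c ≠ 0 := by
    intro h
    rw [hcdef] at h
    have := congrArg norm (sub_eq_zero.1 h)
    rw [norm_mul, norm_mul, hn1, hn2, norm_inv, Complex.norm_real, Real.norm_of_nonneg hr0.le]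
      at this
    linarith
  have hdne : d ≠ 0 := by rw [← hcd]; simpa using hcne
  have hnd : ‖d‖ = ‖c‖ := by rw [← hcd, Complex.norm_conj]
  have hncpos : 0 < ‖c‖ := norm_pos_iff.2 hcne
  obtain ⟨t₀, ht₀⟩ : ∃ t₀ : ℝ, t₀ =
    2 * Real.cos θ * (r - r⁻¹) * (r ^ 2 - r⁻¹ ^ 2) / Complex.normSq c := ⟨_, rfl⟩
  have ht₀pos : 0 < t₀ := by
    have := Complex.normSq_pos.2 hcne
    have : 0 < r - r⁻¹ := by linarith
    have : 0 < r ^ 2 - r⁻¹ ^ 2 := by nlinarith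
    rw [ht₀]; positivity
  have ht₀c : (t₀ : ℂ) = (c + d) * (r ^ 2 - (r : ℂ)⁻¹ ^ 2) / (c * d) := by
    rw [ht₀]
    push_cast
    rw [← Complex.mul_conj, hcd]
    congr 2
    push_cast at hsum
    rw [hcdef, hddef, ← hsum]; ring
  obtain ⟨k, hk⟩ : ∃ k, k = (r : ℂ)⁻¹ := ⟨_, rfl⟩
  have hrk : r * k = 1 := by rw [hk, mul_inv_cancel₀ hrc]
  rw [← hk] at hcdef hddef ht₀c
  simp only [← hk] at hx hy
  have factor : ∀ u : ℂ, u ≠ 0 → u + u⁻¹ + (r + k) = (u + r) * (u + k) / u := fun u hu => by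
    field_simp
    linear_combination -hrk
  have hac : r * d / c + r = r * (c + d) / c := by field_simp; ring
  have hak : r * d / c + k = e₂ * (r ^ 2 - k ^ 2) / c := by
    field_simp
    rw [hcdef, hddef]
    ring
  have hbc : r * c / d + r = r * (c + d) / d := by field_simp
  have hbk : r * c / d + k = e₁ * (r ^ 2 - k ^ 2) / d := by
    field_simp
    rw [hcdef, hddef]
    ring
  have ha0 : r * d / c ≠ 0 := by positivity
  have hb0 : r * c / d ≠ 0 := by positivity
  have haroot : r * d / c + (r * d / c)⁻¹ = e₂ * t₀ - (r + k) := by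
    rw [eq_sub_iff_add_eq, factor _ ha0, hac, hak, ht₀c]
    field_simp
  have hbroot : r * c / d + (r * c / d)⁻¹ = e₁ * t₀ - (r + k) := by
    rw [eq_sub_iff_add_eq, factor _ hb0, hbc, hbk, ht₀c]
    field_simp
  have hrn : ‖(r : ℂ)‖ = r := by rw [Complex.norm_real, Real.norm_of_nonneg hr0.le]
  refine ⟨s * t₀, mul_pos hc.pos ht₀pos, ?_⟩
  ext z
  obtain ⟨t, rfl⟩ : ∃ t, z = s * t := ⟨z / s, by field_simp⟩
  rw [Set.mem_ofPred_eq, Set.mem_insert_iff, Set.mem_singleton_iff, hexp]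
  constructor
  · intro h
    obtain ⟨na, ha, -⟩ := aMap_spec (muMap θ γ (s * t))
    obtain ⟨nb, hb, -⟩ := aMap_spec (muMap (-θ) γ (s * t))
    rw [hx] at ha
    rw [hy] at hb
    generalize aMap (muMap θ γ (s * t)) = a at *
    generalize aMap (muMap (-θ) γ (s * t)) = b at *
    rw [eq_sub_iff_add_eq, factor _ na, div_eq_iff na] at ha
    rw [eq_sub_iff_add_eq, factor _ nb, div_eq_iff nb] at hb
    have hfac : (a + r) * (a * c - r * d) = 0 := by
      have hbe : b = r ^ 2 / a := by rw [← h]; field_simp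
      have hkr : k = 1 / r := by rw [hk, one_div]
      have hb2 : (r + a) * (r ^ 3 + a) = e₁ * t * (a * r ^ 2) := by
        rw [hbe, hkr] at hb
        field_simp at hb
        linear_combination hb
      have hmain : r ^ 2 * e₁ * ((a + r) * (a + k)) = e₂ * ((r + a) * (r ^ 3 + a)) := by
        rw [ha, hb2]; ring
      have : r * ((a + r) * (a * c - r * d)) = 0 := by
        rw [hcdef, hddef]
        linear_combination hmain + (-(a + r) * a * e₂) * hrk
      exact (mul_eq_zero.1 this).resolve_left hrc
    rcases mul_eq_zero.1 hfac with h2 | h2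
    · left
      rw [h2, zero_mul, eq_comm] at ha
      have : t = 0 := by
        have h3 : e₂ ≠ 0 := right_ne_zero_of_mul_eq_one hee
        simpa [na, h3] using ha
      rw [this, mul_zero]
    · right
      have hae : a = r * d / c := by
        rw [eq_div_iff hcne]; exact sub_eq_zero.1 h2
      have h4 : e₂ * t = e₂ * t₀ := by
        have e := haroot
        rw [← hae, eq_sub_iff_add_eq, factor _ na, div_eq_iff na] at e
        exact mul_right_cancel₀ na (ha.symm.trans e)
      rw [mul_left_cancel₀ (right_ne_zero_of_mul_eq_one hee) h4]
      push_cast; rfl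
  · rintro (h | h)
    · have ht : t = 0 := by simpa [hs] using h
      have e : ((-r : ℂ)) + (-r : ℂ)⁻¹ = -(r + k) := by rw [hk, inv_neg]; ring
      have hnr : 1 < ‖(-r : ℂ)‖ := by rw [norm_neg, hrn]; exact hr1
      rw [aMap_eq_of_add_inv (a := -r) (by rw [hx, ht, e]; ring) hnr,
        aMap_eq_of_add_inv (a := -r) (by rw [hy, ht, e]; ring) hnr]
      ring
    · have ht : t = t₀ := by
        push_cast at h
        exact mul_left_cancel₀ hs h
      rw [aMap_eq_of_add_inv (a := r * d / c) (by rw [hx, ht, haroot]) (by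
          rw [norm_div, norm_mul, hrn, hnd, mul_div_cancel_right₀ _ hncpos.ne']; exact hr1),
        aMap_eq_of_add_inv (a := r * c / d) (by rw [hy, ht, hbroot]) (by
          rw [norm_div, norm_mul, hrn, hnd, mul_div_cancel_right₀ _ hncpos.ne']; exact hr1)]
      field_simp

/-- Given `m` roots of the secular polynomial in the upper half plane, there is a further root
on the real axis, different from the root `0`. -/
lemma exists_real_root_secPoly {θ r : ℝ} (hr : 0 < r) (hθ : 0 < Real.cos θ) {m : ℕ}
    {S : Finset ℂ} (hcard : S.card = m) (hS : ∀ t ∈ S, 0 < t.im ∧ (secPoly θ r m).eval t = 0) :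
    ∃ ρ : ℝ, ρ ≠ 0 ∧ (secPoly θ r m).eval (ρ : ℂ) = 0 := by
  set D := secPoly θ r m with hD
  have hdeg : D.natDegree = 2 * (m + 1) := secPoly_natDegree θ r m
  have hD0 : D ≠ 0 := fun h => by simp [h] at hdeg
  have hinj : Function.Injective (starRingEnd ℂ) := (starRingEnd ℂ).injective
  set T : Finset ℂ := insert 0 (S ∪ S.image (starRingEnd ℂ)) with hT
  have hdisj : Disjoint S (S.image (starRingEnd ℂ)) := by
    rw [Finset.disjoint_left]
    intro t ht ht'
    obtain ⟨u, hu, rfl⟩ := Finset.mem_image.1 ht'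
    have h1 := (hS _ ht).1
    have h2 := (hS _ hu).1
    rw [Complex.conj_im] at h1
    linarith
  have h0T : (0 : ℂ) ∉ S ∪ S.image (starRingEnd ℂ) := by
    rw [Finset.mem_union, not_or]
    have : (0 : ℂ) ∉ S := fun h => by simpa using (hS 0 h).1
    refine ⟨this, fun h => ?_⟩
    obtain ⟨u, hu, hu0⟩ := Finset.mem_image.1 h
    rw [map_eq_zero] at hu0
    exact this (hu0 ▸ hu)
  have hTcard : T.card = 2 * m + 1 := by
    rw [hT, Finset.card_insert_of_notMem h0T, Finset.card_union_of_disjoint hdisj,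
      Finset.card_image_of_injective _ hinj, hcard]
    ring
  have hTconj : T.image (starRingEnd ℂ) = T := by
    rw [hT, Finset.image_insert, Finset.image_union, Finset.image_image, map_zero,
      Finset.union_comm]
    congr 2
    rw [show starRingEnd ℂ ∘ starRingEnd ℂ = id from funext Complex.conj_conj, Finset.image_id]
  have hTroot : ∀ t ∈ T, D.eval t = 0 := by
    intro t ht
    rw [hT, Finset.mem_insert, Finset.mem_union, Finset.mem_image] at ht
    rcases ht with rfl | ht | ⟨u, hu, rfl⟩
    · exact secPoly_eval_zero θ hr m
    · exact (hS t ht).2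
    · rw [hD, secPoly_eval_conj, (hS u hu).2, map_zero]
  have hle : T.val ≤ D.roots := (Multiset.le_iff_subset T.nodup).2 fun t ht =>
    (mem_roots hD0).2 (hTroot t ht)
  obtain ⟨W, hW⟩ := Multiset.le_iff_exists_add.1 hle
  have hWcard : W.card = 1 := by
    have h1 := congrArg Multiset.card hW
    rw [IsAlgClosed.card_roots_eq_natDegree, hdeg, Multiset.card_add, Finset.card_val, hTcard] at h1
    omega
  obtain ⟨ρ, rfl⟩ := Multiset.card_eq_one.1 hWcard
  have hDconj : D.map (starRingEnd ℂ) = D := by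
    apply Polynomial.funext
    intro z
    conv_lhs => rw [← Complex.conj_conj z, eval_map_apply]
    rw [← secPoly_eval_conj, Complex.conj_conj]
  have hroots : D.roots.map (starRingEnd ℂ) = D.roots := by
    rw [← (IsAlgClosed.splits D).roots_map, hDconj]
  have hTval : T.val.map (starRingEnd ℂ) = T.val := by
    rw [← Finset.image_val_of_injOn hinj.injOn, hTconj]
  rw [hW, Multiset.map_add, hTval, Multiset.map_singleton] at hroots
  have hρ : starRingEnd ℂ ρ = ρ := Multiset.singleton_inj.1 (add_left_cancel hroots)
  obtain ⟨x, rfl⟩ := Complex.conj_eq_iff_real.1 hρ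
  have hxr : (x : ℂ) ∈ D.roots := by rw [hW]; simp
  refine ⟨x, fun hx => ?_, (mem_roots hD0).1 hxr⟩
  have hmult : 1 < D.rootMultiplicity 0 := by
    rw [← count_roots, hW, hx, Multiset.count_add]
    have : 1 ≤ T.val.count 0 := Multiset.one_le_count_iff_mem.2 (Finset.mem_insert_self _ _)
    rw [Complex.ofReal_zero, Multiset.count_singleton_self]
    omega
  exact secPoly_derivative_zero_ne hr hθ m ((one_lt_rootMultiplicity_iff_isRoot hD0).1 hmult).2

/-- If the eigenvalues include as many distinct points as the size of the matrix, both ways of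
counting eigenvalues in a region count these points. -/
lemma count_eq_of_subset_spectrum {n : ℕ} {A : Matrix (Fin n) (Fin n) ℂ} {E : Finset ℂ}
    (hE : ∀ z ∈ E, z ∈ spectrum ℂ A) (hcard : E.card = n) {S : Set ℂ} {F : Finset ℂ}
    (hF : ∀ z, z ∈ F ↔ z ∈ E ∧ z ∈ S) :
    (spectrum ℂ A ∩ S).ncard = F.card ∧ eigenvalueCount A S = F.card := by
  classical
  have hne : A.charpoly ≠ 0 := A.charpoly_monic.ne_zero
  have hroots : A.charpoly.roots = E.val := by
    refine (Multiset.eq_of_le_of_card_le ((Multiset.le_iff_subset E.nodup).2 fun z hz => ?_) ?_).symm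
    · exact (mem_roots hne).2 (Matrix.mem_spectrum_iff_isRoot_charpoly.1 (hE z hz))
    · refine (card_roots' _).trans ?_
      rw [Matrix.charpoly_natDegree_eq_dim, Fintype.card_fin, Finset.card_val, hcard]
  constructor
  · have : spectrum ℂ A ∩ S = (F : Set ℂ) := by
      ext z
      rw [Set.mem_inter_iff, Matrix.mem_spectrum_iff_isRoot_charpoly, ← mem_roots hne, hroots,
        Finset.mem_coe, hF, Finset.mem_val]
    rw [this, Set.ncard_coe_finset]
  · rw [eigenvalueCount, hroots, ← Finset.card_val]
    congr 1
    refine (Multiset.Nodup.ext (E.nodup.filter _) F.nodup).2 fun z => ?_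
    rw [Multiset.mem_filter, Finset.mem_val, Finset.mem_val, hF]

lemma mem_muSegment_iff {γ r s : ℝ} (hc : CoeffData γ r s) (θ : ℝ) (z : ℂ) :
    z ∈ muSegment θ γ ↔ ∃ c ∈ Set.Icc (-1 : ℝ) 1,
      z = s * (Complex.exp (Complex.I * θ) * ((2 * c + (r + r⁻¹) : ℝ) : ℂ)) := by
  have hs : (s : ℂ) ≠ 0 := by exact_mod_cast hc.pos.ne'
  obtain ⟨t, rfl⟩ : ∃ t, z = s * t := ⟨z / s, by field_simp⟩
  have h := two_mul_muMap hc θ t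
  have hee : Complex.exp (Complex.I * θ) * Complex.exp (-(Complex.I * θ)) = 1 := by
    rw [← Complex.exp_add]; simp
  rw [muSegment, Set.mem_preimage, Set.mem_image]
  refine exists_congr fun c => and_congr_right fun _ => ?_
  rw [mul_right_inj' hs]
  push_cast
  constructor
  · intro hcm
    rw [← hcm] at h
    linear_combination (-t) * hee - Complex.exp (Complex.I * θ) * h
  · intro ht
    linear_combination (-1 / 2 : ℂ) * h - (1 / 2 : ℂ) * Complex.exp (-(Complex.I * θ)) * ht
      - (1 / 2 : ℂ) * (2 * c + (r + (r : ℂ)⁻¹)) * hee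

lemma conj_mem_muSegment_neg {γ r s : ℝ} (hc : CoeffData γ r s) {θ : ℝ} {z : ℂ}
    (hz : z ∈ muSegment θ γ) : starRingEnd ℂ z ∈ muSegment (-θ) γ := by
  obtain ⟨c, hcI, rfl⟩ := (mem_muSegment_iff hc θ z).1 hz
  refine (mem_muSegment_iff hc (-θ) _).2 ⟨c, hcI, ?_⟩
  rw [map_mul, map_mul, Complex.conj_ofReal, Complex.conj_ofReal, conj_exp_I_mul]
  simp

lemma conj_mem_thickening_muSegment_neg {γ r s : ℝ} (hc : CoeffData γ r s) {θ ε : ℝ} {z : ℂ}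
    (hz : z ∈ Metric.thickening ε (muSegment θ γ)) :
    starRingEnd ℂ z ∈ Metric.thickening ε (muSegment (-θ) γ) := by
  obtain ⟨w, hw, hd⟩ := Metric.mem_thickening_iff.1 hz
  refine Metric.mem_thickening_iff.2 ⟨_, conj_mem_muSegment_neg hc hw, ?_⟩
  rwa [Complex.dist_conj_conj]

lemma im_pos_of_mem_thickening_muSegment {γ r s : ℝ} (hc : CoeffData γ r s) {θ ε : ℝ}
    (hθ : 0 < Real.sin θ) (hε : ε < s * (Real.sin θ * (r + r⁻¹ - 2))) {z : ℂ}
    (hz : z ∈ Metric.thickening ε (muSegment θ γ)) : 0 < z.im := by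
  obtain ⟨w, hw, hd⟩ := Metric.mem_thickening_iff.1 hz
  obtain ⟨c, hcI, rfl⟩ := (mem_muSegment_iff hc θ w).1 hw
  have h1 := (Complex.abs_im_le_norm _).trans (dist_eq_norm z _ ▸ hd).le
  rw [Complex.sub_im, Complex.im_ofReal_mul, Complex.im_mul_ofReal, mul_comm Complex.I,
    Complex.exp_ofReal_mul_I_im] at h1
  have h2 := (abs_le.1 h1).1
  have h3 : s * (Real.sin θ * (r + r⁻¹ - 2)) ≤ s * (Real.sin θ * (2 * c + (r + r⁻¹))) := by
    have := hc.pos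
    have := hcI.1
    gcongr
    linarith
  linarith

lemma im_neg_of_mem_thickening_muSegment_neg {γ r s : ℝ} (hc : CoeffData γ r s) {θ ε : ℝ}
    (hθ : 0 < Real.sin θ) (hε : ε < s * (Real.sin θ * (r + r⁻¹ - 2))) {z : ℂ}
    (hz : z ∈ Metric.thickening ε (muSegment (-θ) γ)) : z.im < 0 := by
  have h := conj_mem_thickening_muSegment_neg hc hz
  rw [neg_neg] at h
  simpa using im_pos_of_mem_thickening_muSegment hc hθ hε h

/-- For long chains, the spectrum consists of `N - 1` points near each band and two real
points. -/
lemma exists_eigenvalue_partition {θ γ r s : ℝ} (h0 : 0 < θ) (h1 : θ < Real.pi / 2)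
    (hc : CoeffData γ r s) {ε : ℝ} (hε0 : 0 < ε)
    (hε : ε < s * (Real.sin θ * (r + r⁻¹ - 2))) :
    ∃ m₀ : ℕ, ∀ m ≥ m₀, ∃ (A B : Finset ℂ) (x : ℝ), A.card = m ∧ B.card = m ∧ x ≠ 0 ∧
      (∀ z ∈ A, z ∈ Metric.thickening ε (muSegment θ γ)) ∧
      (∀ z ∈ B, z ∈ Metric.thickening ε (muSegment (-θ) γ)) ∧
      ∀ z ∈ (A ∪ B) ∪ {0, (x : ℂ)}, z ∈ spectrum ℂ (genGaugeCapMatrix θ γ (m + 1)) := by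
  have hr0 : 0 < r := by linarith [hc.one_lt]
  have hcos : 0 < Real.cos θ := Real.cos_pos_of_mem_Ioo ⟨by linarith, h1⟩
  have hsin : 0 < Real.sin θ := Real.sin_pos_of_pos_of_lt_pi h0 (by linarith)
  have hs : (s : ℂ) ≠ 0 := by exact_mod_cast hc.pos.ne'
  have hO : IsOpen ((fun t : ℂ => (s : ℂ) * t) ⁻¹' Metric.thickening ε (muSegment θ γ)) :=
    Metric.isOpen_thickening.preimage (by fun_prop)
  obtain ⟨m₀, hm₀⟩ := exists_secPoly_roots_near_band h0 h1 hc.one_lt hO (fun c hcI =>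
    Metric.self_subset_thickening hε0 _ ((mem_muSegment_iff hc θ _).2 ⟨c, hcI, rfl⟩))
  refine ⟨m₀, fun m hm => ?_⟩
  obtain ⟨S, hScard, hS⟩ := hm₀ m hm
  have hSim : ∀ t ∈ S, 0 < t.im := fun t ht => by
    have := im_pos_of_mem_thickening_muSegment hc hsin hε (hS t ht).1
    rw [Complex.im_ofReal_mul] at this
    exact pos_of_mul_pos_right this hc.pos.le
  obtain ⟨ρ, hρ0, hρ⟩ := exists_real_root_secPoly hr0 hcos hScard fun t ht =>
    ⟨hSim t ht, (hS t ht).2⟩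
  have hmul : Function.Injective fun t : ℂ => (s : ℂ) * t := mul_right_injective₀ hs
  have hconj : Function.Injective (starRingEnd ℂ) := (starRingEnd ℂ).injective
  refine ⟨S.image fun t => (s : ℂ) * t, (S.image fun t => (s : ℂ) * t).image (starRingEnd ℂ),
    s * ρ, ?_, ?_, mul_ne_zero hc.pos.ne' hρ0, ?_, ?_, ?_⟩
  · rw [Finset.card_image_of_injective _ hmul, hScard]
  · rw [Finset.card_image_of_injective _ hconj, Finset.card_image_of_injective _ hmul, hScard]
  · intro z hz
    obtain ⟨t, ht, rfl⟩ := Finset.mem_image.1 hz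
    exact (hS t ht).1
  · intro z hz
    obtain ⟨w, hw, rfl⟩ := Finset.mem_image.1 hz
    obtain ⟨t, ht, rfl⟩ := Finset.mem_image.1 hw
    exact conj_mem_thickening_muSegment_neg hc (hS t ht).1
  · intro z hz
    simp only [Finset.mem_union, Finset.mem_image, Finset.mem_insert, Finset.mem_singleton,
      exists_exists_and_eq_and] at hz
    rcases hz with (⟨t, ht, rfl⟩ | ⟨t, ht, rfl⟩) | rfl | rfl
    · exact mem_spectrum_of_secPoly_root hc (hS t ht).2
    · rw [map_mul, Complex.conj_ofReal]
      apply mem_spectrum_of_secPoly_root hc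
      rw [secPoly_eval_conj, (hS t ht).2, map_zero]
    · have := mem_spectrum_of_secPoly_root hc (secPoly_eval_zero θ hr0 m)
      rwa [mul_zero] at this
    · push_cast
      exact mem_spectrum_of_secPoly_root hc hρ

end

theorem proposition4p10 (θ γ : ℝ) (hθ0 : 0 < θ) (hθ1 : θ < Real.pi / 2) (hγ : 0 < γ) :
    (∃ ε₀ : ℝ, 0 < ε₀ ∧ ∀ ε : ℝ, 0 < ε → ε < ε₀ → ∃ N₀ : ℕ, ∀ N : ℕ, N₀ ≤ N →
      -- exactly two eigenvalues lie outside the neighbourhood of `K`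
      -- (without and with multiplicity)
      (spectrum ℂ (genGaugeCapMatrix θ γ N) \
        Metric.thickening ε (muSegment θ γ ∪ muSegment (-θ) γ)).ncard = 2 ∧
      eigenvalueCount (genGaugeCapMatrix θ γ N)
        (Metric.thickening ε (muSegment θ γ ∪ muSegment (-θ) γ))ᶜ = 2 ∧
      -- exactly `N - 1` eigenvalues lie near each of the two segments
      -- (without and with multiplicity)
      ∀ s : ℝ, s = 1 ∨ s = -1 →
        (spectrum ℂ (genGaugeCapMatrix θ γ N) ∩
          Metric.thickening ε (muSegment (s * θ) γ)).ncard = N - 1 ∧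
        eigenvalueCount (genGaugeCapMatrix θ γ N)
          (Metric.thickening ε (muSegment (s * θ) γ)) = N - 1) ∧
    -- the limiting equation has exactly two solutions, both real: `0` and some `p > 0`
    (∃ p : ℝ, 0 < p ∧
      {z : ℂ | aMap (muMap θ γ z) * aMap (muMap (-θ) γ z) = Complex.exp γ} = {0, (p : ℂ)}) := by
  obtain ⟨r, s, hc⟩ := exists_coeffData hγ
  have hsin : 0 < Real.sin θ := Real.sin_pos_of_pos_of_lt_pi hθ0 (by linarith)
  refine ⟨⟨s * (Real.sin θ * (r + r⁻¹ - 2)), ?_, fun ε hε0 hε => ?_⟩,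
    exists_limiting_solutions hθ0 hθ1 hc⟩
  · exact mul_pos hc.pos (mul_pos hsin (sub_pos.2 (two_lt_add_inv hc.one_lt)))
  obtain ⟨m₀, hm₀⟩ := exists_eigenvalue_partition hθ0 hθ1 hc hε0 hε
  refine ⟨m₀ + 1, fun N hN => ?_⟩
  obtain ⟨m, rfl⟩ : ∃ m, N = m + 1 := ⟨N - 1, by omega⟩
  obtain ⟨A, B, x, hA, hB, hx, hAt, hBt, hspec⟩ := hm₀ m (by omega)
  have hpos : ∀ z ∈ Metric.thickening ε (muSegment θ γ), 0 < z.im := fun z =>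
    im_pos_of_mem_thickening_muSegment hc hsin hε
  have hneg : ∀ z ∈ Metric.thickening ε (muSegment (-θ) γ), z.im < 0 := fun z =>
    im_neg_of_mem_thickening_muSegment_neg hc hsin hε
  have hreal : ∀ z ∈ ({0, (x : ℂ)} : Finset ℂ), z.im = 0 := by
    intro z hz
    rw [Finset.mem_insert, Finset.mem_singleton] at hz
    rcases hz with rfl | rfl <;> simp
  have hpair : ({0, (x : ℂ)} : Finset ℂ).card = 2 :=
    Finset.card_pair (by exact_mod_cast hx.symm)
  have hAB : Disjoint A B := Finset.disjoint_left.2 fun z h1 h2 =>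
    lt_asymm (hpos z (hAt z h1)) (hneg z (hBt z h2))
  have hABx : Disjoint (A ∪ B) ({0, (x : ℂ)} : Finset ℂ) := by
    refine Finset.disjoint_left.2 fun z h1 h2 => ?_
    have h := hreal z h2
    rcases Finset.mem_union.1 h1 with h1 | h1
    · exact (hpos z (hAt z h1)).ne' h
    · exact (hneg z (hBt z h1)).ne h
  have hcard : ((A ∪ B) ∪ {0, (x : ℂ)}).card = 2 * (m + 1) := by
    rw [Finset.card_union_of_disjoint hABx, Finset.card_union_of_disjoint hAB, hA, hB, hpair]
    ring
  have hout := count_eq_of_subset_spectrum hspec hcard (F := {0, (x : ℂ)})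
      (S := (Metric.thickening ε (muSegment θ γ ∪ muSegment (-θ) γ))ᶜ) (by
    intro z
    rw [Metric.thickening_union, Finset.mem_union, Finset.mem_union, Set.mem_compl_iff,
      Set.mem_union]
    constructor
    · intro h
      refine ⟨.inr h, ?_⟩
      rintro (h' | h')
      · exact (hpos z h').ne' (hreal z h)
      · exact (hneg z h').ne (hreal z h)
    · rintro ⟨(h | h) | h, hn⟩
      · exact (hn (.inl (hAt z h))).elim
      · exact (hn (.inr (hBt z h))).elim
      · exact h)
  have hup := count_eq_of_subset_spectrum hspec hcard (F := A)
      (S := Metric.thickening ε (muSegment θ γ)) (by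
    intro z
    rw [Finset.mem_union, Finset.mem_union]
    refine ⟨fun h => ⟨.inl (.inl h), hAt z h⟩, ?_⟩
    rintro ⟨(h | h) | h, h'⟩
    · exact h
    · exact (lt_asymm (hpos z h') (hneg z (hBt z h))).elim
    · exact ((hpos z h').ne' (hreal z h)).elim)
  have hdown := count_eq_of_subset_spectrum hspec hcard (F := B)
      (S := Metric.thickening ε (muSegment (-θ) γ)) (by
    intro z
    rw [Finset.mem_union, Finset.mem_union]
    refine ⟨fun h => ⟨.inl (.inr h), hBt z h⟩, ?_⟩
    rintro ⟨(h | h) | h, h'⟩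
    · exact (lt_asymm (hpos z (hAt z h)) (hneg z h')).elim
    · exact h
    · exact ((hneg z h').ne (hreal z h)).elim)
  rw [hpair] at hout
  rw [hA] at hup
  rw [hB] at hdown
  rw [Nat.add_sub_cancel]
  refine ⟨by rw [Set.sdiff_eq]; exact hout.1, hout.2, fun σ hσ => ?_⟩
  rcases hσ with rfl | rfl
  · rwa [one_mul]
  · rwa [neg_one_mul]
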